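/- Let $M\cong\mathbb{Z}^n$ with $n\ge 0$, and put $N_{\mathbb R}=\operatorname{Hom}(M,\mathbb{R})$ and $\langle x,u\rangle=x(u)$. Let $\mathbb{B}=\{0,1\}$ (with $1+1=1$) be the Boolean semifield and $\mathbb{T}=(\mathbb{R}\cup\{-\infty\},\max,+)$ the tropical semifield. Write $t^a\in\mathbb T$ for the element given by $a\in\mathbb R$, and $\log$ for the inverse of $a\mapsto t^a$. **Definitions.** * A congruence $P$ on an additively idempotent commutative semiring $R$ is *prime* if it is proper and $R/P$ is cancellative and totally ordered by $a\le b\iff a+b=b$. We write $f\le_P g$ if $f\le g$ holds in $R/P$. * Let $V$ be $N_{\mathbb R}$ or $\mathbb{R}\times N_{\mathbb R}$. A *flag of cones* in $V$ is a finite, possibly empty, sequence $\mathcal{C}_\bullet=(\mathcal{C}_0\le\dots\le\mathcal{C}_k)$ of strongly convex polyhedral cones, each a face of the next, with $\dim\mathcal{C}_i=i+1$. It is *simplicial* if every $\mathcal C_i$ is a simplicial cone. A flag of cones in $\mathbb{R}_{\ge0}\times N_{\mathbb R}$ is one in $\mathbb{R}\times N_{\mathbb R}$ all of whose cones lie in $\mathbb{R}_{\ge0}\times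 N_{\mathbb R}$. * A *rational cone* in $N_{\mathbb R}$ is a set $\{x:\langle x,u_i\rangle\le0,\ i=1,\dots,q\}$ with $q\ge 0$ and $u_i\in M$. An *$\mathbb R$-admissible cone* is a set $\{(r,x)\in\mathbb{R}_{\ge0}\times N_{\mathbb R}: r\gamma_i+\langle x,u_i\rangle\le0,\ i=1,\dots,q\}$ with $q\ge 0$, $\gamma_i\in\mathbb{R}$ and $u_i\in M$. *Rational* (resp. *$\mathbb R$-admissible*) *fan support sets* are the finite, possibly empty, unions of such cones. They form a lattice under $\cap$ and $\cup$. * Two flags of cones in $N_{\mathbb R}$ (resp. in $\mathbb{R}_{\ge0}\times N_{\mathbb R}$) are *rationally* (resp. *$\mathbb R$-*) *locally equivalent* if the rational (resp. $\mathbb R$-admissible) cones which meet the relative interior of every cone of the flag are the same for both. * A *prime filter* on a lattice is a proper, nonempty, upward closed subset, closed under meets, such that $a\vee b$ belongs to it only if $a$ or $b$ does. * A *monomial preorder* on a Laurent polynomial ring $k[x_1^{\pm1},\dots,x_n^{\pm1}]$, where $k$ is a nonzero commutative ring, is a total preorder $\preceq$ on its monomials $x^u$, $u\in\mathbb{Z}^n$,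 such that $x^u\preceq x^v$ implies $x^{u+w}\preceq x^{v+w}$ for all $w\in\mathbb Z^n$. **Statement.** There are bijections between the following four sets: 1. the prime congruences on $\mathbb{B}[M]$; 2. the flags of cones in $N_{\mathbb R}$ modulo rational local equivalence; 3. the prime filters on the lattice of rational fan support sets in $N_{\mathbb R}$; 4. the monomial preorders on $k[x_1^{\pm1},\dots,x_n^{\pm1}]$. They are given explicitly as follows. For a prime congruence $P$ on $\mathbb{B}[M]$ let $\widetilde{P}$ be the prime congruence on $\mathbb{T}[M]$ obtained by pulling $P$ back along the map $\mathbb{T}[M]\to\mathbb{B}[M]$ that sends every nonzero coefficient to $1$. * **(2)→(1).** The class of a flag $\mathcal{C}_\bullet$ in $N_{\mathbb R}$ is sent to the prime congruence $P$ determined as follows. The flag $\{0\}\times\mathcal{C}_\bullet$ is $\mathbb{R}$-locally equivalent to some simplicial flag of cones in $\mathbb{R}_{\ge0}\times N_{\mathbb R}$. Let $\mathcal{C}'_\bullet=(\mathcal C'_0\le\dots\le\mathcal C'_k)$ be any such simplicial flag. Then there exist points $w_i=(r_i,\xi_i)\in\mathcal{C}'_i\setminus\mathcal{C}'_{i-1}$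 for $0\le i\le k$ (where $\mathcal{C}'_{-1}=\{0\}$), and for every choice of them $\widetilde P$ is the congruence $$f\sim g\iff\Phi_w(f)=\Phi_w(g),$$ where $\Phi_w(f)$ is the lexicographic maximum, over the $u\in M$ with $f_u\neq0$, of the vectors $(r_i\log f_u+\langle\xi_i,u\rangle)_{0\le i\le k}$, and $\Phi_w(0)=-\infty$. * **(1)→(3).** A prime congruence $P$ is sent to the prime filter $\mathcal{F}$ determined as follows. The sets $\{0\}\times U$, $U\in\mathcal{F}$, generate a prime filter on the lattice of $\mathbb{R}$-admissible fan support sets, and this filter consists of those $\mathbb R$-admissible fan support sets $\widetilde U$ for which there are $f_0,f_1,\dots,f_m\in\mathbb{T}[M]$ with $f_i\le_{\widetilde{P}}f_0$ for $1\le i\le m$ and $$\{w\in\mathbb{R}_{\ge0}\times N_{\mathbb R}:\widetilde f_0(w)\ge\widetilde f_i(w),\ 1\le i\le m\}\subseteq\widetilde U.$$ Here $\widetilde f(r,x)=\max_{u:\,f_u\ne0}\,(r\log f_u+\langle x,u\rangle)$, and $\widetilde f=-\infty$ for $f=0$. * **(1)→(4).** Fix an isomorphism $M\cong\mathbb{Z}^n$.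 A prime congruence $P$ is sent to the preorder with $x^u\preceq x^v\iff\chi^u\le_P\chi^v$. -/

import Mathlib

noncomputable section

/-! ### Max-plus semifields -/

/-- The max-plus semiring `Γ ∪ {-∞}` of a totally ordered abelian group `Γ`: addition is `max`,
multiplication is the addition of `Γ`, `0 = -∞` and `1 = 0_Γ`. -/
def MaxPlus (Γ : Type*) : Type _ := WithBot Γ

instance MaxPlus.instAdd (Γ : Type*) [LinearOrder Γ] : Add (MaxPlus Γ) :=
  ⟨fun a b => max (α := WithBot Γ) a b⟩

instance MaxPlus.instZero (Γ : Type*) : Zero (MaxPlus Γ) := ⟨(⊥ : WithBot Γ)⟩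

instance MaxPlus.instCommSemiring (Γ : Type*) [AddCommGroup Γ] [LinearOrder Γ]
    [IsOrderedAddMonoid Γ] : CommSemiring (MaxPlus Γ) where
  mul a b := (show WithBot Γ from a) + (show WithBot Γ from b)
  one := (0 : WithBot Γ)
  add_assoc a b c := max_assoc (α := WithBot Γ) a b c
  add_comm a b := max_comm (α := WithBot Γ) a b
  zero_add a := max_eq_right (α := WithBot Γ) bot_le
  add_zero a := max_eq_left (α := WithBot Γ) bot_le
  nsmul := nsmulRec
  mul_assoc a b c := add_assoc (G := WithBot Γ) a b c
  mul_comm a b := add_comm (G := WithBot Γ) a b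
  one_mul a := zero_add (M := WithBot Γ) a
  mul_one a := add_zero (M := WithBot Γ) a
  zero_mul a := WithBot.bot_add (α := Γ) a
  mul_zero a := WithBot.add_bot (α := Γ) a
  left_distrib a b c := (max_add_add_left (α := WithBot Γ) a b c).symm
  right_distrib a b c := (max_add_add_right (α := WithBot Γ) a b c).symm

/-- The Boolean semifield `{0, 1}` with `1 + 1 = 1`. -/
abbrev BoolSF : Type := MaxPlus Unit

/-- The tropical semifield `ℝ ∪ {-∞}`. -/
abbrev TropSF : Type := MaxPlus ℝ

/-- The real number underlying a nonzero element of the tropical semifield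
(only used for nonzero arguments). -/
def TropSF.log (a : TropSF) : ℝ := WithBot.unbotD (α := ℝ) 0 a

/-- The semiring homomorphism from the tropical to the Boolean semifield which sends every nonzero
element to `1`. -/
def tropToBool : TropSF →+* BoolSF where
  toFun a := WithBot.map (α := ℝ) (fun _ => ()) a
  map_zero' := rfl
  map_one' := rfl
  map_add' a b := Monotone.map_max (α := WithBot ℝ) (β := WithBot Unit)
    (WithBot.monotone_map_iff.2 fun _ _ _ => le_rfl)
  map_mul' a b := by
    induction a using WithBot.recBotCoe with
    | bot => rfl
    | coe a =>
      induction b using WithBot.recBotCoe with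
      | bot => rfl
      | coe b => rfl

/-- The monoid algebra `𝔹[M]`. -/
abbrev BoolPoly (M : Type*) : Type _ := AddMonoidAlgebra BoolSF M

/-- The monoid algebra `𝕋[M]`. -/
abbrev TropPoly (M : Type*) : Type _ := AddMonoidAlgebra TropSF M

/-- The map `𝕋[M] → 𝔹[M]` induced by `𝕋 → 𝔹`. -/
def tropPolyToBoolPoly (M : Type*) [AddCommGroup M] : TropPoly M →+* BoolPoly M :=
  AddMonoidAlgebra.mapRingHom M tropToBool

/-! ### Prime congruences -/

/-- A congruence `P` on an additively idempotent semiring `R` is prime if it is proper and `R/P` is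
totally ordered (for the canonical order `a ≤ b ↔ a + b = b`) and cancellative. -/
structure IsPrimeCong {R : Type*} [CommSemiring R] (P : RingCon R) : Prop where
  proper : P ≠ ⊤
  total : ∀ a b : P.Quotient, a + b = b ∨ b + a = a
  cancel : ∀ a b c : P.Quotient, a ≠ 0 → a * b = a * c → b = c

/-- The set of prime congruences on `R`. -/
abbrev PrimeCong (R : Type*) [CommSemiring R] : Type _ := {P : RingCon R // IsPrimeCong P}

/-- The relation `a ≤_P b`, i.e. `a ≤ b` in the canonical order of `R/P`. -/
def RingCon.LeMod {R : Type*} [CommSemiring R] (P : RingCon R) (a b : R) : Prop := P (a + b) b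

theorem IsPrimeCong.comap {R R' : Type*} [CommSemiring R] [CommSemiring R'] (f : R →+* R')
    {P : RingCon R'} (hP : IsPrimeCong P) : IsPrimeCong (P.comap f) := by
  have key : ∀ x y : R, ((x : (P.comap f).Quotient) = y) ↔
      ((f x : P.Quotient) = (f y : R')) := by
    intro x y
    rw [RingCon.eq, RingCon.eq, RingCon.comap_rel]
  refine ⟨?_, ?_, ?_⟩
  · intro h
    have h01 : P (0 : R') 1 := by
      have : (P.comap f) (0 : R) 1 := by rw [h]; trivial
      simpa using this
    apply hP.proper
    refine eq_top_iff.2 fun x y _ => ?_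
    have hx : P 0 x := by simpa using P.mul h01 (P.refl x)
    have hy : P 0 y := by simpa using P.mul h01 (P.refl y)
    exact P.trans (P.symm hx) hy
  · intro a b
    obtain ⟨a, rfl⟩ := Quotient.exists_rep a
    obtain ⟨b, rfl⟩ := Quotient.exists_rep b
    have h := hP.total (f a : P.Quotient) (f b : P.Quotient)
    rw [← RingCon.coe_add, ← RingCon.coe_add, ← map_add, ← map_add, ← key, ← key] at h
    exact h
  · intro a b c
    obtain ⟨a, rfl⟩ := Quotient.exists_rep a
    obtain ⟨b, rfl⟩ := Quotient.exists_rep b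
    obtain ⟨c, rfl⟩ := Quotient.exists_rep c
    have h := hP.cancel (f a : P.Quotient) (f b : P.Quotient) (f c : P.Quotient)
    rw [← RingCon.coe_mul, ← RingCon.coe_mul, ← RingCon.coe_zero, Ne, ← map_zero f, ← map_mul,
      ← map_mul, ← key, ← key, ← key] at h
    exact h

/-- A prime congruence on `𝔹[M]`, viewed as a prime congruence on `𝕋[M]` by pulling it back along
`𝕋[M] → 𝔹[M]`. -/
def pullToTrop {M : Type*} [AddCommGroup M] (P : PrimeCong (BoolPoly M)) :
    PrimeCong (TropPoly M) :=
  ⟨P.1.comap (tropPolyToBoolPoly M), P.2.comap _⟩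

/-! ### The space `N_ℝ` and flags of cones -/

/-- `N_ℝ = Hom(M, ℝ)`. -/
abbrev NR (M : Type*) [AddCommGroup M] : Type _ := M →+ ℝ

/-- The topology of pointwise convergence on `N_ℝ`; for `M` free of finite rank it is the usual
topology of the finite-dimensional real vector space `N_ℝ`. -/
instance NR.instTopologicalSpace (M : Type*) [AddCommGroup M] : TopologicalSpace (NR M) :=
  TopologicalSpace.induced (fun x : NR M => (x : M → ℝ)) inferInstance

/-- A flag `C₀ ≤ C₁ ≤ ⋯ ≤ C_k` of strongly convex polyhedral cones in `V`, each a face of the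
following ones, with `dim C_i = i + 1`. Here `length = k + 1`; the empty flag (`length = 0`)
is allowed. -/
@[ext]
structure ConeFlag (V : Type*) [AddCommGroup V] [Module ℝ V] where
  length : ℕ
  cone : Fin length → PointedCone ℝ V
  polyhedral : ∀ i, (cone i).FG
  stronglyConvex : ∀ i, (cone i : ConvexCone ℝ V).Salient
  dim : ∀ i, Module.finrank ℝ (Submodule.span ℝ (cone i : Set V)) = (i : ℕ) + 1
  face : ∀ i j, i ≤ j → (cone i).IsFaceOf (cone j)

namespace ConeFlag

variable {V : Type*} [AddCommGroup V] [Module ℝ V]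

/-- A flag is simplicial if all of its cones are. -/
def IsSimplicial (F : ConeFlag V) : Prop := ∀ i, (F.cone i).IsSimplicial

/-- `D` is a neighborhood of the flag if it meets the relative interior of each of its cones. -/
def IsNbhd [TopologicalSpace V] (F : ConeFlag V) (D : Set V) : Prop :=
  ∀ i, (D ∩ intrinsicInterior ℝ (F.cone i : Set V)).Nonempty

/-- Given a class `𝒜` of admissible cones, two flags are locally equivalent if they have the same
neighborhoods in `𝒜`. -/
def LocEquiv [TopologicalSpace V] (𝒜 : Set (Set V)) (F F' : ConeFlag V) : Prop :=
  ∀ D ∈ 𝒜, F.IsNbhd D ↔ F'.IsNbhd D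

/-- A choice of points `w_i ∈ C_i \ C_{i-1}`, where `C_{-1} = {0}`. -/
def IsChoice (F : ConeFlag V) (w : Fin F.length → V) : Prop :=
  ∀ i, w i ∈ F.cone i ∧ w i ≠ 0 ∧ ∀ j, j < i → w i ∉ F.cone j

/-- The flag lies in `ℝ_{≥0} × V`. -/
def InHalfSpace (F : ConeFlag (ℝ × V)) : Prop := ∀ i, ∀ w ∈ F.cone i, 0 ≤ w.1

/-- A flag in `V` considered as a flag in `ℝ_{≥0} × V` by adding a first coordinate `0`. -/
def zeroSlice (F : ConeFlag V) : ConeFlag (ℝ × V) where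
  length := F.length
  cone i := (F.cone i).map (LinearMap.inr ℝ ℝ V)
  polyhedral i := (F.polyhedral i).map _
  stronglyConvex i := by
    rintro _ ⟨x, hx, rfl⟩ hne ⟨y, hy, hxy⟩
    have hyx : y = -x := congrArg Prod.snd hxy
    refine F.stronglyConvex i x hx ?_ (by rw [← hyx]; exact hy)
    rintro rfl
    exact hne (by simp)
  dim i := by
    rw [← F.dim i]
    have h : Submodule.span ℝ (((F.cone i).map (LinearMap.inr ℝ ℝ V) : PointedCone ℝ (ℝ × V)) :
        Set (ℝ × V)) = (Submodule.span ℝ (F.cone i : Set V)).map (LinearMap.inr ℝ ℝ V) := by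
      rw [Submodule.map_span]; rfl
    rw [h]
    exact (Submodule.equivMapOfInjective _ LinearMap.inr_injective _).finrank_eq.symm
  face i j hij := (F.face i j hij).map _ LinearMap.inr_injective

end ConeFlag

/-! ### Rational and `ℝ`-admissible cones -/

/-- The rational cones `{x ∈ N_ℝ : ⟨x, u_i⟩ ≤ 0 for i = 1, …, q}` with `u_i ∈ M`. -/
def rationalCones (M : Type*) [AddCommGroup M] : Set (Set (NR M)) :=
  {D | ∃ s : Finset M, D = {x | ∀ u ∈ s, x u ≤ 0}}

/-- The `ℝ`-admissible cones `{(r, x) ∈ ℝ_{≥0} × N_ℝ : r γ_i + ⟨x, u_i⟩ ≤ 0 for i = 1, …, q}`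
with `γ_i ∈ ℝ` and `u_i ∈ M`. -/
def admissibleCones (M : Type*) [AddCommGroup M] : Set (Set (ℝ × NR M)) :=
  {D | ∃ s : Finset (ℝ × M), D = {w | 0 ≤ w.1 ∧ ∀ p ∈ s, w.1 * p.1 + w.2 p.2 ≤ 0}}

theorem rationalCones_infClosed (M : Type*) [AddCommGroup M] : InfClosed (rationalCones M) := by
  classical
  rintro _ ⟨s, rfl⟩ _ ⟨t, rfl⟩
  refine ⟨s ∪ t, ?_⟩
  ext x
  simp only [Set.inf_eq_inter, Set.mem_inter_iff, Set.mem_ofPred_eq, Finset.mem_union]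
  constructor
  · rintro ⟨h1, h2⟩ u (hu | hu)
    exacts [h1 u hu, h2 u hu]
  · exact fun h => ⟨fun u hu => h u (Or.inl hu), fun u hu => h u (Or.inr hu)⟩

theorem admissibleCones_infClosed (M : Type*) [AddCommGroup M] :
    InfClosed (admissibleCones M) := by
  classical
  rintro _ ⟨s, rfl⟩ _ ⟨t, rfl⟩
  refine ⟨s ∪ t, ?_⟩
  ext x
  simp only [Set.inf_eq_inter, Set.mem_inter_iff, Set.mem_ofPred_eq, Finset.mem_union]
  constructor
  · rintro ⟨⟨h0, h1⟩, -, h2⟩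
    refine ⟨h0, ?_⟩
    rintro u (hu | hu)
    exacts [h1 u hu, h2 u hu]
  · exact fun ⟨h0, h⟩ => ⟨⟨h0, fun u hu => h u (Or.inl hu)⟩, h0, fun u hu => h u (Or.inr hu)⟩

/-- Rational local equivalence of flags of cones in `N_ℝ`. -/
def ratLocEquiv (M : Type*) [AddCommGroup M] : Setoid (ConeFlag (NR M)) where
  r := ConeFlag.LocEquiv (rationalCones M)
  iseqv :=
    { refl := fun _ _ _ => Iff.rfl
      symm := fun h D hD => (h D hD).symm
      trans := fun h h' D hD => (h D hD).trans (h' D hD) }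

/-! ### Lattices of fan support sets and prime filters -/

/-- The lattice (under `∩` and `∪`) of finite unions, possibly empty, of members of `𝒜`. -/
def fanSupportLattice {V : Type*} (𝒜 : Set (Set V)) (h𝒜 : InfClosed 𝒜) : Sublattice (Set V) where
  carrier := {U | ∃ S : Set (Set V), S.Finite ∧ S ⊆ 𝒜 ∧ U = ⋃₀ S}
  supClosed' := by
    rintro _ ⟨S, hS, hS', rfl⟩ _ ⟨T, hT, hT', rfl⟩
    exact ⟨S ∪ T, hS.union hT, Set.union_subset hS' hT', (Set.sUnion_union S T).symm⟩
  infClosed' := by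
    rintro _ ⟨S, hS, hS', rfl⟩ _ ⟨T, hT, hT', rfl⟩
    refine ⟨Set.image2 (· ∩ ·) S T, hS.image2 _ hT, ?_, ?_⟩
    · rintro _ ⟨A, hA, B, hB, rfl⟩
      exact h𝒜 (hS' hA) (hT' hB)
    · ext x
      simp only [Set.inf_eq_inter, Set.mem_inter_iff, Set.mem_sUnion, Set.mem_image2]
      constructor
      · rintro ⟨⟨A, hA, hxA⟩, B, hB, hxB⟩
        exact ⟨A ∩ B, ⟨A, hA, B, hB, rfl⟩, hxA, hxB⟩
      · rintro ⟨_, ⟨A, hA, B, hB, rfl⟩, hxA, hxB⟩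
        exact ⟨⟨A, hA, hxA⟩, B, hB, hxB⟩

/-- The lattice of rational fan support sets in `N_ℝ`. -/
abbrev ratFanLattice (M : Type*) [AddCommGroup M] : Sublattice (Set (NR M)) :=
  fanSupportLattice (rationalCones M) (rationalCones_infClosed M)

/-- The lattice of `ℝ`-admissible fan support sets in `ℝ_{≥0} × N_ℝ`. -/
abbrev admFanLattice (M : Type*) [AddCommGroup M] : Sublattice (Set (ℝ × NR M)) :=
  fanSupportLattice (admissibleCones M) (admissibleCones_infClosed M)

/-- The set of prime filters on a lattice `L`. -/
abbrev PrimeFilter (L : Type*) [Lattice L] : Type _ := {F : Order.PFilter L // F.IsPrime}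

/-- The filter on the lattice of `ℝ`-admissible fan support sets generated by the sets `{0} × U`
with `U` in the filter `F` on the lattice of rational fan support sets in `N_ℝ`. -/
def generatedByZeroSlice {M : Type*} [AddCommGroup M] (F : Order.PFilter (ratFanLattice M)) :
    Set (admFanLattice M) :=
  {U' | ∃ U ∈ F, (fun x : NR M => ((0 : ℝ), x)) '' (U : Set (NR M)) ⊆ (U' : Set (ℝ × NR M))}

/-! ### Congruences on `𝕋[M]` defined by flags, and filters defined by congruences -/

/-- The homogenized function `(r, x) ↦ max_u (r log f_u + ⟨x, u⟩)` of `f ∈ 𝕋[M]`, the maximum being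
over the `u` with `f_u ≠ 0`; it is `-∞` for `f = 0`. -/
def tropEval {M : Type*} [AddCommGroup M] (f : TropPoly M) (w : ℝ × NR M) : WithBot ℝ :=
  f.coeff.support.sup fun u => ((w.1 * TropSF.log (f.coeff u) + w.2 u : ℝ) : WithBot ℝ)

/-- The set of `ℝ`-admissible fan support sets `U` for which there are `f₀, f₁, …, f_m ∈ 𝕋[M]` with
`{w ∈ ℝ_{≥0} × N_ℝ : f₀(w) ≥ f_i(w) for all i} ⊆ U` and `f_i ≤_P f₀` for all `i`. -/
def filterOfTropCong {M : Type*} [AddCommGroup M] (P : RingCon (TropPoly M)) :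
    Set (admFanLattice M) :=
  {U | ∃ (f₀ : TropPoly M) (s : Finset (TropPoly M)), (∀ f ∈ s, P.LeMod f f₀) ∧
    {w : ℝ × NR M | 0 ≤ w.1 ∧ ∀ f ∈ s, tropEval f w ≤ tropEval f₀ w} ⊆ (U : Set (ℝ × NR M))}

/-- The map `𝕋[M] → ℝ^ℓ ∪ {-∞}` with
`f ↦ max_u (r_i log f_u + ⟨x_i, u⟩)_i`, where `w i = (r_i, x_i)` and the maximum is lexicographic
and over the `u` with `f_u ≠ 0`. -/
def lexEval {M : Type*} [AddCommGroup M] {ℓ : ℕ} (w : Fin ℓ → ℝ × NR M) (f : TropPoly M) :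
    WithBot (Lex (Fin ℓ → ℝ)) :=
  f.coeff.support.sup fun u =>
    ((toLex fun i => (w i).1 * TropSF.log (f.coeff u) + (w i).2 u : Lex (Fin ℓ → ℝ)) :
      WithBot (Lex (Fin ℓ → ℝ)))

/-- `P` is the congruence on `𝕋[M]` defined by the flag `F`: points `w_i ∈ C_i \ C_{i-1}` exist and,
for every choice of them, `f` and `g` are congruent iff `lexEval w f = lexEval w g`. -/
def ConeFlag.Defines {M : Type*} [AddCommGroup M] (F : ConeFlag (ℝ × NR M))
    (P : RingCon (TropPoly M)) : Prop :=
  (∃ w, F.IsChoice w) ∧ ∀ w, F.IsChoice w → ∀ f g, P f g ↔ lexEval w f = lexEval w g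

/-! ### Monomial preorders -/

/-- The monoid of monomials `x^u`, `u ∈ ℤ^n`, of the Laurent polynomial ring
`k[x₁^{±1}, …, x_n^{±1}]`. -/
abbrev LaurentMonomials (k : Type*) [CommRing k] (n : ℕ) :
    Submonoid (AddMonoidAlgebra k (Fin n → ℤ)) :=
  MonoidHom.mrange (AddMonoidAlgebra.of k (Fin n → ℤ))

/-- The Laurent monomial `x^u`. -/
def laurentMonomial (k : Type*) [CommRing k] {n : ℕ} (u : Fin n → ℤ) : LaurentMonomials k n :=
  ⟨AddMonoidAlgebra.of k (Fin n → ℤ) (Multiplicative.ofAdd u), _, rfl⟩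

/-- A multiplicative total preorder on the commutative monoid `A`. -/
@[ext]
structure MonomialPreorder (A : Type*) [CommMonoid A] where
  le : A → A → Prop
  total : ∀ a b, le a b ∨ le b a
  trans : ∀ a b c, le a b → le b c → le a c
  mul_right : ∀ a b c, le a b → le (a * c) (b * c)

end

open scoped Topology

noncomputable section

/-! ### The sign of the first nonzero entry -/

/-! All four kinds of objects encode one datum: a submonoid `S` of `M` with `S ∪ -S = M`, the set of
nonpositive elements of a translation invariant total preorder. A prime congruence gives the `u`
with `χ^u ≤ 1`, a flag the `u` that are lexicographically nonpositive on points `w_i ∈ C_i \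
C_{i-1}`, a prime filter the `u` whose half space belongs to it, a monomial preorder the `u` with
`x^u ≼ 1`. Each assignment is a bijection with `TotalSubmonoid M`, and the required maps are
composites.

Two facts carry the proof. By `TotalSubmonoid.exists_lex`, every total submonoid comes from the
lexicographic order of finitely many linearly independent points of `N_ℝ`: an archimedean argument
(`AddSubmonoid.exists_real_hom_of_total`) on the common kernel of the functionals found so far
supplies the next one, and the dimension bounds the process. This realizes each `S` by a flag and by
a congruence. By `exists_pos_forall_sign`, the single point `∑ ε^j w_j` with small `ε > 0`
reproduces the lexicographic signs of finitely many functionals. Hence being a neighborhood of a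
flag is a lexicographic condition (`ConeFlag.isNbhd_iff`), and finitely many elements of `S` can be
separated from finitely many outside it, which makes the filter of `S` prime.

For the explicit formulas, admissible neighborhoods of `{0} × C` ignore the constants `γ`. So on any
flag locally equivalent to it the lexicographic signs are independent of `γ`, and `Φ_w` compares
terms by their exponents alone, as the pulled back congruence does. On the filter side, `t^1 ≤ 1`
holds modulo that congruence and forces `r = 0`, so only traces on `{0} × N_ℝ` matter. -/

/-- The first nonzero entry of `a` exists and is positive. -/
def LexPos {ℓ : ℕ} (a : Fin ℓ → ℝ) : Prop := ∃ i, (∀ j < i, a j = 0) ∧ 0 < a i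

theorem LexPos.of_castLE {m ℓ : ℕ} (h : m ≤ ℓ) {a : Fin ℓ → ℝ}
    (ha : LexPos fun j : Fin m => a (Fin.castLE h j)) : LexPos a := by
  obtain ⟨i, hi, hpos⟩ := ha
  refine ⟨Fin.castLE h i, fun j hj => ?_, hpos⟩
  have hj' : (j : ℕ) < i := hj
  exact hi ⟨j, hj'.trans i.2⟩ hj'

theorem LexPos.not_neg {ℓ : ℕ} {a : Fin ℓ → ℝ} (ha : LexPos a) : ¬ LexPos fun i => -a i := by
  rintro ⟨i, hi, hpos⟩
  obtain ⟨j, hj, hpos'⟩ := ha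
  rcases lt_trichotomy i j with h | rfl | h
  · linarith [hj i h]
  · linarith
  · linarith [hi j h]

theorem eq_zero_of_not_lexPos {ℓ : ℕ} {a : Fin ℓ → ℝ} (h : ¬ LexPos a)
    (h' : ¬ LexPos fun i => -a i) (i : Fin ℓ) : a i = 0 := by
  induction i using WellFoundedLT.induction with
  | _ i ih =>
    rcases lt_trichotomy (a i) 0 with hi | hi | hi
    · exact absurd ⟨i, fun j hj => by simp [ih j hj], by linarith⟩ h'
    · exact hi
    · exact absurd ⟨i, ih, hi⟩ h

/-- The first nonzero entry dominates as `ε → 0⁺`. If it is the constant term, continuity at `0`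
suffices; otherwise a factor `ε` splits off and the tail is treated by induction. -/
theorem LexPos.eventually_sum_pos {ℓ : ℕ} {a : Fin ℓ → ℝ} (ha : LexPos a) :
    ∀ᶠ ε : ℝ in 𝓝[>] 0, 0 < ∑ j : Fin ℓ, ε ^ (j : ℕ) * a j := by
  induction ℓ with
  | zero => exact ha.choose.elim0
  | succ ℓ ih =>
    obtain ⟨i, hi, hpos⟩ := ha
    induction i using Fin.cases with
    | zero =>
      have hc : Continuous fun ε : ℝ => ∑ j : Fin (ℓ + 1), ε ^ (j : ℕ) * a j := by fun_prop
      have h0 : 0 < ∑ j : Fin (ℓ + 1), (0 : ℝ) ^ (j : ℕ) * a j := by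
        simpa [Fin.sum_univ_succ] using hpos
      exact (hc.tendsto 0).eventually_const_lt h0 |>.filter_mono nhdsWithin_le_nhds
    | succ i =>
      have h0 : a 0 = 0 := hi 0 (Fin.succ_pos i)
      have hS : LexPos fun j => a (Fin.succ j) :=
        ⟨i, fun j hj => hi j.succ (Fin.succ_lt_succ_iff.2 hj), hpos⟩
      filter_upwards [ih hS, self_mem_nhdsWithin] with ε hε hε0
      have : ∑ j : Fin (ℓ + 1), ε ^ (j : ℕ) * a j =
          ε * ∑ j : Fin ℓ, ε ^ (j : ℕ) * a (Fin.succ j) := by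
        rw [Fin.sum_univ_succ, Finset.mul_sum, h0, mul_zero, zero_add]
        exact Finset.sum_congr rfl fun _ _ => by rw [Fin.val_succ, pow_succ', mul_assoc]
      rw [this]
      exact mul_pos hε0 hε

theorem eventually_sum_nonpos {ℓ : ℕ} {a : Fin ℓ → ℝ} (ha : ¬ LexPos a) :
    ∀ᶠ ε : ℝ in 𝓝[>] 0, ∑ j : Fin ℓ, ε ^ (j : ℕ) * a j ≤ 0 := by
  by_cases h : LexPos fun i => -a i
  · filter_upwards [h.eventually_sum_pos] with ε hε
    simp only [mul_neg, Finset.sum_neg_distrib] at hε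
    linarith
  · simp [eq_zero_of_not_lexPos ha h]

/-- Finitely many functionals take at a suitable positive combination of `w 0, w 1, …` the
sign prescribed by the lexicographic order. -/
theorem exists_pos_forall_sign {V ι : Type*} [AddCommGroup V] [Module ℝ V] {ℓ : ℕ} (w : Fin ℓ → V)
    (S : Set ι) (hS : S.Finite) (l : ι → V →+ ℝ) (hl : ∀ i, ∀ (c : ℝ) x, l i (c • x) = c * l i x) :
    ∃ ε : ℝ, 0 < ε ∧ ∀ i ∈ S,
      (LexPos (fun j => l i (w j)) → 0 < l i (∑ j : Fin ℓ, ε ^ (j : ℕ) • w j)) ∧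
      (¬ LexPos (fun j => l i (w j)) → l i (∑ j : Fin ℓ, ε ^ (j : ℕ) • w j) ≤ 0) := by
  have key : ∀ i ∈ S, ∀ᶠ ε : ℝ in 𝓝[>] 0,
      (LexPos (fun j => l i (w j)) → 0 < l i (∑ j : Fin ℓ, ε ^ (j : ℕ) • w j)) ∧
      (¬ LexPos (fun j => l i (w j)) → l i (∑ j : Fin ℓ, ε ^ (j : ℕ) • w j) ≤ 0) := by
    intro i _
    by_cases h : LexPos fun j => l i (w j)
    · filter_upwards [h.eventually_sum_pos] with ε hε
      simpa [h, hl] using hε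
    · filter_upwards [eventually_sum_nonpos h] with ε hε
      simpa [h, hl] using hε
  obtain ⟨ε, h1, h2⟩ := (((hS.eventually_all).2 key).and
    (self_mem_nhdsWithin (a := (0 : ℝ)) (s := Set.Ioi 0))).exists
  exact ⟨ε, h2, h1⟩

/-! ### Relative interiors of polyhedral cones -/

section RelInt

variable {V : Type*} [AddCommGroup V] [Module ℝ V]

theorem PointedCone.mem_affineSpan_iff (C : PointedCone ℝ V) {x : V} :
    x ∈ affineSpan ℝ (C : Set V) ↔ x ∈ Submodule.span ℝ (C : Set V) := by
  have h : insert (0 : V) (C : Set V) = C := Set.insert_eq_of_mem C.zero_mem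
  have := affineSpan_insert_zero (k := ℝ) (C : Set V)
  rw [h] at this
  rw [← SetLike.mem_coe, this, SetLike.mem_coe]

/-- For a finitely generated cone, some point can be moved a little away from every other. -/
theorem PointedCone.exists_mem_forall_sub_mem {C : PointedCone ℝ V} (hC : C.FG) :
    ∃ x ∈ C, ∀ y ∈ C, ∃ ε : ℝ, 0 < ε ∧ x - ε • y ∈ C := by
  classical
  obtain ⟨s, rfl⟩ := hC
  have hs : ∀ g ∈ s, g ∈ Submodule.span {c : ℝ // 0 ≤ c} (s : Set V) := fun g hg =>
    Submodule.subset_span hg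
  have hx : ∑ g ∈ s, g ∈ Submodule.span {c : ℝ // 0 ≤ c} (s : Set V) := sum_mem hs
  refine ⟨∑ g ∈ s, g, hx, fun y hy => ?_⟩
  induction hy using Submodule.span_induction with
  | mem g hg =>
    refine ⟨1, one_pos, ?_⟩
    rw [one_smul, ← Finset.sum_erase_eq_sub hg]
    exact sum_mem fun i hi => hs i (Finset.mem_of_mem_erase hi)
  | zero => exact ⟨1, one_pos, by simpa using hx⟩
  | add y z hy hz ihy ihz =>
    obtain ⟨a, ha, hya⟩ := ihy
    obtain ⟨b, hb, hzb⟩ := ihz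
    -- Average `x - a • y` and `x - b • z` with weights `b / (a + b)` and `a / (a + b)`: both `y`
    -- and `z` then get the coefficient `a * b / (a + b)`.
    refine ⟨a * b / (a + b), by positivity, ?_⟩
    have h1 := PointedCone.smul_mem _ (r := b / (a + b)) (by positivity) hya
    have h2 := PointedCone.smul_mem _ (r := a / (a + b)) (by positivity) hzb
    convert add_mem h1 h2 using 1
    match_scalars <;> field_simp
    ring
  | smul c y hy ihy =>
    obtain ⟨a, ha, hya⟩ := ihy
    rcases eq_or_lt_of_le c.2 with hc | hc
    · refine ⟨1, one_pos, ?_⟩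
      have : c = 0 := Subtype.ext hc.symm
      simpa [this] using hx
    · refine ⟨a / c, by positivity, ?_⟩
      have : (a / (c : ℝ)) • (c • y) = a • y := by
        change (a / (c : ℝ)) • ((c : ℝ) • y) = a • y
        rw [smul_smul, div_mul_cancel₀ _ hc.ne']
      rwa [this]

variable [TopologicalSpace V] [IsTopologicalAddGroup V] [ContinuousSMul ℝ V]

/-- The line through `x` in direction `y` stays in the affine span of `C`, so a short piece of it
around `x` stays in `C`. -/
theorem PointedCone.exists_sub_mem_of_mem_intrinsicInterior {C : PointedCone ℝ V} {x : V}
    (hx : x ∈ intrinsicInterior ℝ (C : Set V)) {y : V} (hy : y ∈ C) :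
    ∃ ε : ℝ, 0 < ε ∧ x - ε • y ∈ C := by
  obtain ⟨z, hz, rfl⟩ := hx
  have hz' := C.mem_affineSpan_iff.1 z.2
  let γ : ℝ → affineSpan ℝ (C : Set V) := fun t => ⟨z - t • y, C.mem_affineSpan_iff.2
    (sub_mem hz' (Submodule.smul_mem _ _ (Submodule.subset_span hy)))⟩
  have hγ : Continuous γ := by
    apply Continuous.subtype_mk
    fun_prop
  have h0 : γ 0 = z := Subtype.ext (by simp [γ])
  have hev : ∀ᶠ t in 𝓝 (0 : ℝ),
      γ t ∈ interior ((↑) ⁻¹' (C : Set V) : Set (affineSpan ℝ (C : Set V))) :=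
    (hγ.tendsto 0).eventually (by rw [h0]; exact isOpen_interior.mem_nhds hz)
  obtain ⟨ε, h1, h2⟩ := ((hev.filter_mono nhdsWithin_le_nhds).and
    (self_mem_nhdsWithin (a := (0 : ℝ)) (s := Set.Ioi 0))).exists
  exact ⟨ε, h2, (interior_subset h1 : γ ε ∈ ((↑) ⁻¹' (C : Set V) : Set (affineSpan ℝ (C : Set V))))⟩

/-- Converse of the preceding lemma. Choose a basis of the span inside `C` and move from `x` by `-δ`
times the sum of the basis without leaving `C`. A point of the span whose coordinates exceed those
of `x` minus `δ` is the moved point plus a nonnegative combination of the basis; such points form a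
neighborhood of `x`. -/
theorem PointedCone.mem_intrinsicInterior_of_forall [T2Space V] [Module.Finite ℝ V]
    {C : PointedCone ℝ V} {x : V} (hx : x ∈ C) (h : ∀ y ∈ C, ∃ ε : ℝ, 0 < ε ∧ x - ε • y ∈ C) :
    x ∈ intrinsicInterior ℝ (C : Set V) := by
  obtain ⟨b, hbC, hspan, hli⟩ := exists_linearIndependent ℝ (C : Set V)
  have : Finite b := hli.finite
  cases nonempty_fintype b
  let B := Module.Basis.span hli
  obtain ⟨δ, hδ, hsub⟩ := h (∑ i : b, (i : V)) (sum_mem fun i _ => hbC i.2)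
  have hS : ∀ z : affineSpan ℝ (C : Set V),
      (z : V) ∈ Submodule.span ℝ (Set.range ((↑) : b → V)) := fun z => by
    rw [Subtype.range_coe, hspan]
    exact C.mem_affineSpan_iff.1 z.2
  let φ : affineSpan ℝ (C : Set V) → Submodule.span ℝ (Set.range ((↑) : b → V)) :=
    fun z => ⟨z, hS z⟩
  have hφ : Continuous φ := Continuous.subtype_mk continuous_subtype_val _
  let x' : affineSpan ℝ (C : Set V) := ⟨x, subset_affineSpan ℝ _ hx⟩
  refine ⟨x', ?_, rfl⟩
  rw [mem_interior_iff_mem_nhds]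
  have hev : ∀ᶠ z in 𝓝 x', ∀ i, B.coord i (φ x') - δ < B.coord i (φ z) := by
    rw [Filter.eventually_all]
    intro i
    have hc : Continuous fun z => B.coord i (φ z) :=
      (LinearMap.continuous_of_finiteDimensional (B.coord i)).comp hφ
    exact (hc.tendsto x').eventually_const_lt (by linarith)
  filter_upwards [hev] with z hz
  have hz' : (z : V) = (x - δ • ∑ i : b, (i : V)) +
      ∑ i : b, (δ + (B.coord i (φ z) - B.coord i (φ x'))) • (i : V) := by
    have h1 : ∀ y, ((φ y : Submodule.span ℝ (Set.range ((↑) : b → V))) : V) =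
        ∑ i : b, B.coord i (φ y) • (i : V) := fun y => by
      conv_lhs => rw [← B.sum_repr (φ y)]
      simp [B, Module.Basis.span_apply]
    have h2 : (z : V) = ∑ i : b, B.coord i (φ z) • (i : V) := h1 z
    have h3 : x = ∑ i : b, B.coord i (φ x') • (i : V) := h1 x'
    simp only [add_smul, sub_smul, Finset.sum_add_distrib, Finset.sum_sub_distrib, ← h2, ← h3,
      Finset.smul_sum]
    abel
  rw [Set.mem_preimage, hz']
  refine add_mem hsub (sum_mem fun i _ => C.smul_mem ?_ (hbC i.2))
  linarith [hz i]

theorem PointedCone.nonempty_intrinsicInterior [T2Space V] [Module.Finite ℝ V]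
    {C : PointedCone ℝ V} (hC : C.FG) : (intrinsicInterior ℝ (C : Set V)).Nonempty := by
  obtain ⟨x, hx, h⟩ := PointedCone.exists_mem_forall_sub_mem hC
  exact ⟨x, PointedCone.mem_intrinsicInterior_of_forall hx h⟩

theorem PointedCone.smul_add_mem_intrinsicInterior [T2Space V] [Module.Finite ℝ V]
    {C : PointedCone ℝ V} {x y : V} (hx : x ∈ intrinsicInterior ℝ (C : Set V)) {c : ℝ} (hc : 0 < c)
    (hy : y ∈ C) : c • x + y ∈ intrinsicInterior ℝ (C : Set V) := by
  have hx' : x ∈ C := intrinsicInterior_subset hx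
  refine PointedCone.mem_intrinsicInterior_of_forall
    (add_mem (C.smul_mem hc.le hx') hy) fun z hz => ?_
  obtain ⟨ε, hε, h⟩ := PointedCone.exists_sub_mem_of_mem_intrinsicInterior hx hz
  refine ⟨c * ε, by positivity, ?_⟩
  convert add_mem (C.smul_mem hc.le h) hy using 1
  module

/-- A point of the relative interior of a cone lies on no proper face. -/
theorem PointedCone.IsFaceOf.le_of_mem_intrinsicInterior {F C : PointedCone ℝ V}
    (hF : F.IsFaceOf C) {x : V} (hx : x ∈ intrinsicInterior ℝ (C : Set V)) (hxF : x ∈ F) :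
    C ≤ F := by
  intro y hy
  obtain ⟨ε, hε, h⟩ := PointedCone.exists_sub_mem_of_mem_intrinsicInterior hx hy
  exact hF.mem_of_smul_add_mem hy h hε (by simpa using hxF)

end RelInt

/-! ### Choices of points on a flag -/

section Face

variable {V : Type*} [AddCommGroup V] [Module ℝ V]

theorem PointedCone.exists_sub_of_mem_span {F : PointedCone ℝ V} {x : V}
    (hx : x ∈ Submodule.span ℝ (F : Set V)) : ∃ a ∈ F, ∃ b ∈ F, x = a - b := by
  induction hx using Submodule.span_induction with
  | mem x hx => exact ⟨x, hx, 0, F.zero_mem, by simp⟩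
  | zero => exact ⟨0, F.zero_mem, 0, F.zero_mem, by simp⟩
  | add x y _ _ ihx ihy =>
    obtain ⟨a, ha, b, hb, rfl⟩ := ihx
    obtain ⟨a', ha', b', hb', rfl⟩ := ihy
    exact ⟨a + a', add_mem ha ha', b + b', add_mem hb hb', by abel⟩
  | smul c x _ ih =>
    obtain ⟨a, ha, b, hb, rfl⟩ := ih
    rcases le_total 0 c with hc | hc
    · exact ⟨c • a, F.smul_mem hc ha, c • b, F.smul_mem hc hb, smul_sub ..⟩
    · exact ⟨(-c) • b, F.smul_mem (by linarith) hb, (-c) • a,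
        F.smul_mem (by linarith) ha, by module⟩

/-- An element of the span of `F` is `a - b` with `a, b ∈ F`; adding `b` to `y` reduces to the face
property of `F` itself. -/
theorem PointedCone.IsFaceOf.mem_of_smul_add_mem_span {F C : PointedCone ℝ V} (hF : F.IsFaceOf C)
    {x y : V} (hx : x ∈ C) (hy : y ∈ C) {c : ℝ} (hc : 0 < c)
    (h : c • x + y ∈ Submodule.span ℝ (F : Set V)) : x ∈ F := by
  obtain ⟨a, ha, b, hb, hab⟩ := PointedCone.exists_sub_of_mem_span h
  refine hF.mem_of_smul_add_mem hx (add_mem hy (hF.le hb)) hc ?_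
  rwa [← add_assoc, hab, sub_add_cancel]

/-- Modulo the span of a facet, all points of a cone which are not on the facet are positive
multiples of each other. -/
theorem PointedCone.IsFaceOf.exists_pos_sub_smul_mem [Module.Finite ℝ V] {F C : PointedCone ℝ V}
    (hF : F.IsFaceOf C)
    (hdim : Module.finrank ℝ (Submodule.span ℝ (C : Set V)) =
      Module.finrank ℝ (Submodule.span ℝ (F : Set V)) + 1)
    {w x : V} (hw : w ∈ C) (hwF : w ∉ F) (hx : x ∈ C) (hxF : x ∉ F) :
    ∃ c : ℝ, 0 < c ∧ x - c • w ∈ Submodule.span ℝ (F : Set V) := by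
  have hmem : ∀ y ∈ C, y ∉ F → y ∉ Submodule.span ℝ (F : Set V) := fun y hy hyF h =>
    hyF (hF.mem_of_smul_add_mem_span hy C.zero_mem one_pos (by simpa using h))
  -- Since the facet has codimension one, its span and `w` together span everything.
  have hsup : Submodule.span ℝ (F : Set V) ⊔ Submodule.span ℝ {w} =
      Submodule.span ℝ (C : Set V) := by
    refine Submodule.eq_of_le_of_finrank_eq (sup_le (Submodule.span_mono hF.le)
      (Submodule.span_le.2 ?_)) ?_
    · simpa using Submodule.subset_span hw
    · rw [Submodule.finrank_sup_span_singleton (hmem w hw hwF), hdim]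
  have hx' : x ∈ Submodule.span ℝ (F : Set V) ⊔ Submodule.span ℝ {w} :=
    hsup ▸ Submodule.subset_span hx
  obtain ⟨s, hs, t, ht, hst⟩ := Submodule.mem_sup.1 hx'
  obtain ⟨c, rfl⟩ := Submodule.mem_span_singleton.1 ht
  have hxs : x - c • w = s := by rw [← hst, add_sub_cancel_right]
  refine ⟨c, ?_, hxs ▸ hs⟩
  -- If `c ≤ 0`, then `x + (-c) • w` is a sum of two points of `C` in the span of `F`, which forces
  -- `x ∈ F`.
  by_contra hc
  refine hxF (hF.mem_of_smul_add_mem_span hx (C.smul_mem (r := -c) (by linarith) hw)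
    one_pos ?_)
  convert hs using 1
  rw [← hxs]
  module

end Face

namespace ConeFlag

variable {V : Type*} [AddCommGroup V] [Module ℝ V]

/-- The cone preceding the `i`-th cone of a flag (the zero cone for `i = 0`). -/
def pred (F : ConeFlag V) (i : Fin F.length) : PointedCone ℝ V :=
  if (i : ℕ) = 0 then ⊥ else F.cone ⟨i - 1, (Nat.sub_le _ _).trans_lt i.2⟩

theorem pred_isFaceOf (F : ConeFlag V) (i : Fin F.length) : (F.pred i).IsFaceOf (F.cone i) := by
  unfold pred
  split_ifs with h
  · refine ⟨bot_le, fun {x y a} hx hy ha hxy => ?_⟩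
    rw [Submodule.mem_bot] at hxy ⊢
    by_contra hne
    -- `a • x + y = 0` puts both `a • x` and its negative in the cone.
    refine F.stronglyConvex i _ ((F.cone i).smul_mem ha.le hx) (smul_ne_zero ha.ne' hne) ?_
    rwa [← eq_neg_of_add_eq_zero_right hxy]
  · exact F.face _ _ (Fin.mk_le_of_le_val (Nat.sub_le _ _))

theorem finrank_span_pred (F : ConeFlag V) (i : Fin F.length) :
    Module.finrank ℝ (Submodule.span ℝ (F.pred i : Set V)) = i := by
  by_cases h : (i : ℕ) = 0
  · have : Submodule.span ℝ (F.pred i : Set V) = ⊥ := by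
      rw [Submodule.span_eq_bot, pred, if_pos h]; simp
    rw [this, finrank_bot, h]
  · rw [pred, if_neg h, F.dim]
    simp only
    omega

theorem cone_mono (F : ConeFlag V) {i j : Fin F.length} (h : i ≤ j) : F.cone i ≤ F.cone j :=
  (F.face i j h).le

theorem isChoice_iff (F : ConeFlag V) (w : Fin F.length → V) :
    F.IsChoice w ↔ ∀ i, w i ∈ F.cone i ∧ w i ∉ F.pred i := by
  refine forall_congr' fun i => and_congr_right fun _ => ?_
  unfold pred
  split_ifs with h
  · rw [Submodule.mem_bot]
    refine ⟨fun h => h.1, fun h' => ⟨h', fun j hj => ?_⟩⟩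
    have : (j : ℕ) < i := hj
    omega
  · refine ⟨fun h' => h'.2 _ (Fin.mk_lt_of_lt_val (by omega)), fun h' => ⟨?_, fun j hj hj' => ?_⟩⟩
    · rintro h0
      exact h' (h0 ▸ Submodule.zero_mem _)
    · have : (j : ℕ) < i := hj
      exact h' (F.cone_mono (Fin.le_def.2 (by simp only; omega)) hj')

theorem exists_pos_sub_smul_mem [Module.Finite ℝ V] (F : ConeFlag V) {w : Fin F.length → V}
    (hw : F.IsChoice w) {i : Fin F.length} {x : V} (hx : x ∈ F.cone i) (hxF : x ∉ F.pred i) :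
    ∃ c : ℝ, 0 < c ∧ x - c • w i ∈ Submodule.span ℝ (F.pred i : Set V) := by
  rw [isChoice_iff] at hw
  exact (F.pred_isFaceOf i).exists_pos_sub_smul_mem (by rw [F.dim, finrank_span_pred])
    (hw i).1 (hw i).2 hx hxF

/-- The points `w_j` with `j < i` span the same space as the preceding cone: each of its points
either lies in an earlier cone or is a multiple of the last `w_j` modulo the span of an earlier
cone. -/
theorem map_eq_zero_of_mem_span_pred [Module.Finite ℝ V] (F : ConeFlag V) {w : Fin F.length → V}
    (hw : F.IsChoice w) (l : V →ₗ[ℝ] ℝ) {i : Fin F.length} (h : ∀ j < i, l (w j) = 0) {x : V}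
    (hx : x ∈ Submodule.span ℝ (F.pred i : Set V)) : l x = 0 := by
  induction i using WellFoundedLT.induction generalizing x with
  | _ i ih =>
    suffices Submodule.span ℝ (F.pred i : Set V) ≤ LinearMap.ker l from this hx
    refine Submodule.span_le.2 fun y hy => ?_
    rw [SetLike.mem_coe, LinearMap.mem_ker]
    unfold pred at hy
    split_ifs at hy with h0
    · rw [SetLike.mem_coe, Submodule.mem_bot] at hy
      rw [hy, map_zero]
    · set j : Fin F.length := ⟨i - 1, (Nat.sub_le _ _).trans_lt i.2⟩
      have hj : j < i := Fin.mk_lt_of_lt_val (by omega)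
      by_cases hyj : y ∈ F.pred j
      · exact ih j hj (fun k hk => h k (hk.trans hj)) (Submodule.subset_span hyj)
      · obtain ⟨c, -, hcy⟩ := F.exists_pos_sub_smul_mem hw hy hyj
        have := ih j hj (fun k hk => h k (hk.trans hj)) hcy
        simpa [h j hj] using this

/-- The lexicographic sign of a functional depends on the flag only. At the first index where `l` is
nonzero, two choices differ by a positive factor modulo a span on which `l` vanishes. Exchanging `w`
and `w'` gives the other implication. -/
theorem map_pos_iff [Module.Finite ℝ V] (F : ConeFlag V) {w w' : Fin F.length → V}
    (hw : F.IsChoice w) (hw' : F.IsChoice w') (l : V →ₗ[ℝ] ℝ)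
    (h : LexPos fun i => l (w i)) : LexPos fun i => l (w' i) := by
  obtain ⟨i, hi, hpos⟩ := h
  refine ⟨i, fun j hj => ?_, ?_⟩
  · refine F.map_eq_zero_of_mem_span_pred hw l hi (Submodule.subset_span ?_)
    have : (j : ℕ) < i := hj
    unfold pred
    rw [if_neg (by omega)]
    exact F.cone_mono (Fin.le_def.2 (by simp only; omega)) (hw' j).1
  · obtain ⟨c, hc, hcw⟩ := F.exists_pos_sub_smul_mem hw (hw' i).1 ((F.isChoice_iff w').1 hw' i).2
    have := F.map_eq_zero_of_mem_span_pred hw l hi hcw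
    rw [map_sub, map_smul, smul_eq_mul, sub_eq_zero] at this
    exact (mul_pos hc hpos).trans_eq this.symm

section Topology

variable [TopologicalSpace V] [IsTopologicalAddGroup V] [ContinuousSMul ℝ V]

/-- A relative interior point on the preceding face would make the two cones equal, contradicting
their dimensions. -/
theorem isChoice_of_mem_intrinsicInterior (F : ConeFlag V) {w : Fin F.length → V}
    (hw : ∀ i, w i ∈ intrinsicInterior ℝ (F.cone i : Set V)) : F.IsChoice w := by
  refine (F.isChoice_iff w).2 fun i => ⟨intrinsicInterior_subset (hw i), fun h => ?_⟩
  have h1 := le_antisymm ((F.pred_isFaceOf i).le_of_mem_intrinsicInterior (hw i) h)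
    (F.pred_isFaceOf i).le
  have h2 := F.dim i
  rw [h1, finrank_span_pred] at h2
  omega

variable [T2Space V] [Module.Finite ℝ V]

theorem exists_mem_intrinsicInterior (F : ConeFlag V) :
    ∃ w : Fin F.length → V, ∀ i, w i ∈ intrinsicInterior ℝ (F.cone i : Set V) :=
  ⟨_, fun i => (PointedCone.nonempty_intrinsicInterior (F.polyhedral i)).some_mem⟩

/-- A polyhedral cone is a neighborhood of a flag iff its defining functionals are
lexicographically nonpositive on the flag. -/
theorem isNbhd_iff (F : ConeFlag V) {w : Fin F.length → V} (hw : F.IsChoice w)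
    {S : Set (V →ₗ[ℝ] ℝ)} (hS : S.Finite) :
    F.IsNbhd {x | ∀ l ∈ S, l x ≤ 0} ↔ ∀ l ∈ S, ¬ LexPos fun i => l (w i) := by
  constructor
  · intro h l hl hpos
    choose p hp using h
    obtain ⟨i, -, hi⟩ := F.map_pos_iff hw (F.isChoice_of_mem_intrinsicInterior fun i => (hp i).2)
      l hpos
    exact absurd ((hp i).1 l hl) (by linarith)
  · intro h i
    obtain ⟨v, hv⟩ := F.exists_mem_intrinsicInterior
    have hv' := F.isChoice_of_mem_intrinsicInterior hv
    have hle : (i : ℕ) + 1 ≤ F.length := i.2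
    -- Only the first `i + 1` points are combined, so that the combination lies in `C_i`. Truncation
    -- is harmless, since a lexicographically positive initial segment makes the whole sequence
    -- positive.
    obtain ⟨ε, hε, h1⟩ := exists_pos_forall_sign (fun j => v (Fin.castLE hle j)) S hS
      (fun l => l.toAddMonoidHom) (fun l c x => by simp)
    refine ⟨_, fun l hl => (h1 l hl).2 fun hpos => ?_, ?_⟩
    · have hpos' : LexPos fun j => l (v j) :=
        LexPos.of_castLE (a := fun j => l (v j)) hle hpos
      exact h l hl (F.map_pos_iff hv' hw l hpos')
    -- The last summand is in the relative interior of `C_i`, the others are in `C_i`.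
    · rw [Fin.sum_univ_castSucc, add_comm]
      refine PointedCone.smul_add_mem_intrinsicInterior (hv i) (pow_pos hε _)
        (sum_mem fun j _ => PointedCone.smul_mem _ (pow_pos hε _).le ?_)
      refine F.cone_mono ?_ (hv' _).1
      exact Fin.le_def.2 (by simp)

end Topology

end ConeFlag

/-! ### Total submonoids and homomorphisms to the reals -/

/-- The submonoids `S` of `M` with `S ∪ -S = M`. They are the sets of nonpositive elements of the
translation invariant total preorders on `M`. -/
abbrev TotalSubmonoid (M : Type*) [AddCommGroup M] : Type _ :=
  {S : AddSubmonoid M // ∀ u, u ∈ S ∨ -u ∈ S}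

section RealHom

variable {G : Type*} [AddCommGroup G] {S : AddSubmonoid G}

/-- Read `u ∈ S` as `u ≤ 0`. The bound `g ≥ 0` is the sum of the absolute values of the elements of
`t`. -/
theorem AddSubmonoid.exists_bound_of_total (hS : ∀ u, u ∈ S ∨ -u ∈ S) (t : Finset G) :
    ∃ g, -g ∈ S ∧ ∀ a ∈ t, a - g ∈ S ∧ -a - g ∈ S := by
  classical
  induction t using Finset.induction_on with
  | empty => exact ⟨0, by simp, by simp⟩
  | insert a t _ ih =>
    obtain ⟨g, hg, ht⟩ := ih
    obtain ⟨b, hb, h1, h2⟩ : ∃ b, -b ∈ S ∧ a - b ∈ S ∧ -a - b ∈ S := by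
      rcases hS a with h | h
      · exact ⟨-a, by simpa using h, by simpa using S.add_mem h h, by simp⟩
      · exact ⟨a, h, by simp, by simpa [sub_eq_add_neg] using S.add_mem h h⟩
    refine ⟨g + b, by simpa [add_comm] using S.add_mem hg hb, fun c hc => ?_⟩
    rcases Finset.mem_insert.1 hc with rfl | hc
    · constructor
      · convert S.add_mem h1 hg using 1; abel
      · convert S.add_mem h2 hg using 1; abel
    · constructor
      · convert S.add_mem (ht c hc).1 hb using 1; abel
      · convert S.add_mem (ht c hc).2 hb using 1; abel

/-- A bound for the generators and their negatives is an order unit: every `u` lies between `-N • g`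
and `N • g` for some `N`. -/
theorem AddSubmonoid.exists_bound_of_fg [AddGroup.FG G] (hS : ∀ u, u ∈ S ∨ -u ∈ S) :
    ∃ g, -g ∈ S ∧ ∀ u, ∃ N : ℕ, u - N • g ∈ S ∧ -u - N • g ∈ S := by
  obtain ⟨t, ht⟩ := (AddGroup.fg_def.1 ‹AddGroup.FG G›)
  obtain ⟨g, hg, hb⟩ := AddSubmonoid.exists_bound_of_total hS t
  refine ⟨g, hg, fun u => ?_⟩
  have hu : u ∈ AddSubgroup.closure (t : Set G) := ht ▸ AddSubgroup.mem_top u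
  induction hu using AddSubgroup.closure_induction with
  | mem a ha => exact ⟨1, by simpa using hb a ha⟩
  | zero => exact ⟨0, by simp⟩
  | add a b _ _ iha ihb =>
    obtain ⟨m, h1, h2⟩ := iha
    obtain ⟨n, h3, h4⟩ := ihb
    refine ⟨m + n, ?_, ?_⟩
    · convert S.add_mem h1 h3 using 1; module
    · convert S.add_mem h2 h4 using 1; module
  | neg a _ ih =>
    obtain ⟨n, h1, h2⟩ := ih
    exact ⟨n, h2, by simpa using h1⟩

/-- A nontrivial translation invariant total preorder on a finitely generated abelian group is
weakly monotone for some nonzero homomorphism to the reals. -/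
theorem AddSubmonoid.exists_real_hom_of_total [AddGroup.FG G] (hS : ∀ u, u ∈ S ∨ -u ∈ S)
    (hne : ∃ u, u ∉ S) : ∃ y : G →+ ℝ, y ≠ 0 ∧ ∀ u ∈ S, y u ≤ 0 := by
  obtain ⟨g, hg, hN⟩ := AddSubmonoid.exists_bound_of_fg hS
  -- If the order unit were `≤ 0`, every element would be, contrary to `hne`.
  have hgS : g ∉ S := fun h => by
    obtain ⟨u, hu⟩ := hne
    obtain ⟨N, hN, -⟩ := hN u
    exact hu (by simpa using S.add_mem hN (S.nsmul_mem h N))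
  have hint : ∀ n : ℤ, n • g ∈ S → n ≤ 0 := by
    intro n hn
    by_contra hpos
    obtain ⟨m, rfl⟩ : ∃ m : ℕ, n = m + 1 := ⟨(n - 1).toNat, by omega⟩
    refine hgS ?_
    convert S.add_mem hn (S.nsmul_mem hg m) using 1
    module
  -- Integer part of `q u / g`: the `p` with `p g ≤ q u ≤ (p + 1) g`.
  have hfloor : ∀ u : G, ∀ q : ℕ, ∃ p : ℤ, p • g - q • u ∈ S ∧ q • u - (p + 1) • g ∈ S := by
    intro u q
    obtain ⟨N, h1, h2⟩ := hN (q • u)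
    obtain ⟨p, hp, hmax⟩ := Int.exists_greatest_of_bdd (P := fun p : ℤ => p • g - q • u ∈ S)
      ⟨N, fun z hz => by
        have : (z - N) • g ∈ S := by
          convert S.add_mem hz h1 using 1; module
        linarith [hint _ this]⟩
      ⟨-N, by convert h2 using 1; module⟩
    refine ⟨p, hp, ?_⟩
    rcases hS ((p + 1) • g - q • u) with h | h
    · linarith [hmax _ h]
    · simpa using h
  -- The fractions `p / q` with `p g ≤ q u`; their supremum measures `u` in units of `g` and is the
  -- required homomorphism.
  let A : G → Set ℝ := fun u => {r | ∃ (p : ℤ) (q : ℕ), 0 < q ∧ r = p / q ∧ p • g - q • u ∈ S}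
  have hub : ∀ u (p : ℤ) (q : ℕ), 0 < q → q • u - p • g ∈ S → (p / q : ℝ) ∈ upperBounds (A u) := by
    rintro u p q hq h _ ⟨p', q', hq', rfl, h'⟩
    have : (p' * q - p * q') • g ∈ S := by
      convert S.add_mem (S.nsmul_mem h' q) (S.nsmul_mem h q') using 1; module
    have hle : p' * q ≤ p * q' := by linarith [hint _ this]
    rw [div_le_div_iff₀ (by positivity) (by positivity)]
    exact_mod_cast hle
  have hAne : ∀ u, (A u).Nonempty := fun u => by
    obtain ⟨p, hp, -⟩ := hfloor u 1
    exact ⟨_, p, 1, one_pos, rfl, hp⟩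
  have hAbdd : ∀ u, BddAbove (A u) := fun u => by
    obtain ⟨p, -, hp⟩ := hfloor u 1
    exact ⟨_, hub u (p + 1) 1 one_pos hp⟩
  have hlow : ∀ u (p : ℤ) (q : ℕ), 0 < q → p • g - q • u ∈ S → (p / q : ℝ) ≤ sSup (A u) :=
    fun u p q hq h => le_csSup (hAbdd u) ⟨p, q, hq, rfl, h⟩
  have hup : ∀ u (p : ℤ) (q : ℕ), 0 < q → q • u - p • g ∈ S → sSup (A u) ≤ (p / q : ℝ) :=
    fun u p q hq h => csSup_le (hAne u) (hub u p q hq h)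
  have hadd : ∀ u v, sSup (A (u + v)) = sSup (A u) + sSup (A v) := by
    intro u v
    -- With denominator `n + 1`, the integer parts confine both sides to one interval of length `2 /
    -- (n + 1)`, for arbitrary `n`.
    by_contra hne
    have hd : 0 < |sSup (A (u + v)) - (sSup (A u) + sSup (A v))| / 2 :=
      half_pos (abs_pos.2 (sub_ne_zero.2 hne))
    obtain ⟨n, hn⟩ := exists_nat_one_div_lt hd
    obtain ⟨p, h1, h2⟩ := hfloor u (n + 1)
    obtain ⟨p', h3, h4⟩ := hfloor v (n + 1)
    have e1 := hlow u p (n + 1) n.succ_pos h1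
    have e2 := hup u (p + 1) (n + 1) n.succ_pos h2
    have e3 := hlow v p' (n + 1) n.succ_pos h3
    have e4 := hup v (p' + 1) (n + 1) n.succ_pos h4
    have e5 := hlow (u + v) (p + p') (n + 1) n.succ_pos (by
      convert S.add_mem h1 h3 using 1; module)
    have e6 := hup (u + v) (p + p' + 2) (n + 1) n.succ_pos (by
      convert S.add_mem h2 h4 using 1; module)
    push_cast [add_div] at e1 e2 e3 e4 e5 e6 hn
    have : |sSup (A (u + v)) - (sSup (A u) + sSup (A v))| ≤ 2 * (1 / ((n : ℝ) + 1)) := by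
      rw [abs_le]
      have : (2 : ℝ) / (n + 1) = 2 * (1 / ((n : ℝ) + 1)) := by ring
      constructor <;> linarith
    linarith
  refine ⟨AddMonoidHom.mk' (fun u => sSup (A u)) hadd, fun h => ?_, fun u hu => ?_⟩
  · have h1 : (1 : ℝ) ≤ sSup (A g) := by simpa using hlow g 1 1 one_pos (by simp)
    have h2 : sSup (A g) = 0 := DFunLike.congr_fun h g
    linarith
  · simpa using hup u 0 1 one_pos (by simpa using hu)

end RealHom

/-! ### The topological vector space `N_ℝ` -/

section NRInstances

variable (M : Type*) [AddCommGroup M]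

/-- The inclusion of `N_ℝ` into the space of all functions on `M`. -/
def NR.coeLin : NR M →ₗ[ℝ] (M → ℝ) where
  toFun x := x
  map_add' _ _ := rfl
  map_smul' _ _ := rfl

instance NR.instIsTopologicalAddGroup : IsTopologicalAddGroup (NR M) :=
  topologicalAddGroup_induced (NR.coeLin M)

instance NR.instContinuousSMul : ContinuousSMul ℝ (NR M) :=
  continuousSMul_induced (NR.coeLin M)

instance NR.instT2Space : T2Space (NR M) :=
  (Topology.IsEmbedding.mk ⟨rfl⟩ DFunLike.coe_injective :
    Topology.IsEmbedding fun x : NR M => (x : M → ℝ)).t2Space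

end NRInstances

theorem NR.finite_of_equiv {M : Type*} [AddCommGroup M] {n : ℕ} (e : M ≃+ (Fin n → ℤ)) :
    Module.Finite ℝ (NR M) := by
  let f : NR M →ₗ[ℝ] (Fin n → ℝ) :=
    { toFun := fun x i => x (e.symm (Pi.single i 1))
      map_add' := fun _ _ => rfl
      map_smul' := fun _ _ => rfl }
  refine Module.Finite.of_injective f fun x y h => ?_
  have : x.comp e.symm.toAddMonoidHom = y.comp e.symm.toAddMonoidHom := by
    ext i
    have hi : x (e.symm (Pi.single i 1)) = y (e.symm (Pi.single i 1)) := congr_fun h i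
    simpa using hi
  ext u
  simpa using DFunLike.congr_fun this (e u)

/-! ### Total submonoids are given by lexicographic orders -/

theorem AddSubgroup.exists_extend_real {M : Type*} [AddCommGroup M] (H : AddSubgroup M)
    (y : H →+ ℝ) : ∃ z : M →+ ℝ, ∀ u : H, z u = y u := by
  obtain ⟨z, hz⟩ := (Module.Baer.of_divisible ℝ).extension_property_addMonoidHom H.subtype
    H.subtype_injective y
  exact ⟨z, fun u => DFunLike.congr_fun hz u⟩

/-- A translation invariant total preorder on a lattice is the lexicographic order defined by a
linearly independent sequence of real functionals. -/
theorem TotalSubmonoid.exists_lex {M : Type*} [AddCommGroup M] [AddGroup.FG M]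
    [Module.Finite ℝ (NR M)] (S : TotalSubmonoid M) :
    ∃ (ℓ : ℕ) (x : Fin ℓ → NR M), LinearIndependent ℝ x ∧
      ∀ u, u ∈ S.1 ↔ ¬ LexPos fun i => x i u := by
  -- Partial solutions: independent sequences for which elements of `S` are never lexicographically
  -- positive. One of maximal length turns out to be exact.
  let Q : ℕ → Prop := fun ℓ => ∃ x : Fin ℓ → NR M, LinearIndependent ℝ x ∧
    ∀ u ∈ S.1, ¬ LexPos fun i => x i u
  have h0 : Q 0 := ⟨Fin.elim0, linearIndependent_empty_type, fun u _ ⟨i, _⟩ => i.elim0⟩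
  have hbdd : ∀ ℓ, Q ℓ → ℓ ≤ Module.finrank ℝ (NR M) := fun ℓ ⟨x, hx, _⟩ => by
    simpa using hx.fintype_card_le_finrank
  classical
  obtain ⟨ℓ, ⟨x, hx, hxS⟩, hmax⟩ : ∃ ℓ, Q ℓ ∧ ¬ Q (ℓ + 1) :=
    ⟨Nat.findGreatest Q (Module.finrank ℝ (NR M)), Nat.findGreatest_spec (Nat.zero_le _) h0,
      fun h => absurd (Nat.le_findGreatest (hbdd _ h) h) (by simp)⟩
  refine ⟨ℓ, x, hx, fun u => ⟨hxS u, fun hu => ?_⟩⟩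
  by_contra huS
  have hneg := (S.2 u).resolve_left huS
  let H : AddSubgroup M := ⨅ i, (x i).ker
  have hH : ∀ v, v ∈ H ↔ ∀ i, x i v = 0 := fun v => by
    simp [H, AddSubgroup.mem_iInf, AddMonoidHom.mem_ker]
  -- Neither `u` nor `-u` is lexicographically positive, so all functionals vanish at `u`, and the
  -- preorder restricted to their common kernel `H` is nontrivial.
  have huH : u ∈ H := (hH u).2 (eq_zero_of_not_lexPos hu (by simpa using hxS _ hneg))
  have hM : Module.Finite ℤ M := Module.Finite.iff_addGroup_fg.2 ‹_›
  have : AddGroup.FG H := by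
    have : Module.Finite ℤ (AddSubgroup.toIntSubmodule H) := inferInstance
    exact Module.Finite.iff_addGroup_fg.1 this
  obtain ⟨y, hy0, hy⟩ := AddSubmonoid.exists_real_hom_of_total
    (S := S.1.comap H.subtype) (fun v => S.2 v) ⟨⟨u, huH⟩, huS⟩
  obtain ⟨z, hz⟩ := H.exists_extend_real y
  -- Appending `z` contradicts maximality: it is nonzero on `H`, where the span of `x` vanishes, and
  -- it only matters at elements of `H`, where it is monotone.
  refine hmax ⟨Fin.snoc x z, linearIndependent_finSnoc.2 ⟨hx, fun hmem => ?_⟩, ?_⟩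
  · refine hy0 (AddMonoidHom.ext fun v => ?_)
    rw [← hz, AddMonoidHom.zero_apply]
    have hle : Submodule.span ℝ (Set.range x) ≤
        LinearMap.ker ((LinearMap.proj (v : M)).comp (NR.coeLin M)) := by
      rw [Submodule.span_le]
      rintro _ ⟨i, rfl⟩
      exact (hH v).1 v.2 i
    exact hle hmem
  · rintro v hv ⟨i, hi, hpos⟩
    induction i using Fin.lastCases with
    | last =>
      have hvH : v ∈ H := (hH v).2 fun i => by
        simpa using hi i.castSucc (Fin.castSucc_lt_last i)
      have := hy ⟨v, hvH⟩ hv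
      rw [← hz] at this
      simp only [Fin.snoc_last] at hpos
      exact absurd hpos (by simpa using this)
    | cast i =>
      refine hxS v hv ⟨i, fun j hj => ?_, by simpa using hpos⟩
      simpa using hi j.castSucc (Fin.castSucc_lt_castSucc_iff.2 hj)

/-! ### The flag generated by a linearly independent family -/

section FlagOfFamily

variable {V : Type*} [AddCommGroup V] [Module ℝ V] {ℓ : ℕ} {w : Fin ℓ → V}

theorem LinearIndependent.exists_coord (hw : LinearIndependent ℝ w) (i : Fin ℓ) :
    ∃ f : V →ₗ[ℝ] ℝ, ∀ j, f (w j) = if j = i then 1 else 0 := by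
  obtain ⟨f, hf⟩ := LinearMap.exists_extend ((Finsupp.lapply i).comp hw.repr)
  refine ⟨f, fun j => ?_⟩
  have := DFunLike.congr_fun hf ⟨w j, Submodule.subset_span ⟨j, rfl⟩⟩
  simp only [LinearMap.comp_apply, Submodule.subtype_apply] at this
  rw [this, hw.repr_eq_single j _ rfl]
  simp [Finsupp.single_apply]

theorem PointedCone.map_nonneg_of_mem_hull {s : Set V} {f : V →ₗ[ℝ] ℝ} (hf : ∀ x ∈ s, 0 ≤ f x)
    {x : V} (hx : x ∈ PointedCone.hull ℝ s) : 0 ≤ f x := by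
  induction hx using Submodule.span_induction with
  | mem x hx => exact hf x hx
  | zero => simp
  | add x y _ _ hx hy => rw [map_add]; exact add_nonneg hx hy
  | smul c x _ hx =>
    have : f (c • x) = (c : ℝ) * f x := f.map_smul (c : ℝ) x
    rw [this]
    exact mul_nonneg c.2 hx

theorem PointedCone.mem_hull_image_iff {s : Set (Fin ℓ)} {x : V} :
    x ∈ PointedCone.hull ℝ (w '' s) ↔ ∃ c : Fin ℓ → ℝ, (∀ j, 0 ≤ c j) ∧ (∀ j, j ∉ s → c j = 0) ∧
      x = ∑ j, c j • w j := by
  classical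
  constructor
  · intro hx
    induction hx using Submodule.span_induction with
    | mem x hx =>
      obtain ⟨i, hi, rfl⟩ := hx
      refine ⟨Pi.single i 1, fun j => ?_, fun j hj => ?_, ?_⟩
      · by_cases h : j = i
        · subst h; simp
        · simp [h]
      · exact Pi.single_eq_of_ne (by rintro rfl; exact hj hi) _
      · rw [Finset.sum_eq_single i] <;> simp +contextual
    | zero => exact ⟨0, by simp⟩
    | add x y _ _ hx hy =>
      obtain ⟨c, h1, h2, rfl⟩ := hx
      obtain ⟨d, h3, h4, rfl⟩ := hy
      exact ⟨c + d, fun j => add_nonneg (h1 j) (h3 j), fun j hj => by simp [h2 j hj, h4 j hj],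
        by simp [add_smul, Finset.sum_add_distrib]⟩
    | smul a x _ hx =>
      obtain ⟨c, h1, h2, rfl⟩ := hx
      refine ⟨fun j => a * c j, fun j => mul_nonneg a.2 (h1 j), fun j hj => by simp [h2 j hj], ?_⟩
      change (a : ℝ) • (∑ j, c j • w j) = _
      simp [Finset.smul_sum, mul_smul]
  · rintro ⟨c, h1, h2, rfl⟩
    refine sum_mem fun j _ => ?_
    by_cases hj : j ∈ s
    · exact PointedCone.smul_mem _ (h1 j) (Submodule.subset_span ⟨j, hj, rfl⟩)
    · rw [h2 j hj, zero_smul]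
      exact zero_mem _

/-- The flag of simplicial cones generated by the initial segments of a linearly independent
sequence. -/
def ConeFlag.ofLinearIndependent (hw : LinearIndependent ℝ w) : ConeFlag V where
  length := ℓ
  cone i := PointedCone.hull ℝ (w '' Set.Iic i)
  polyhedral i := Submodule.fg_span ((Set.toFinite _).image _)
  stronglyConvex i := by
    intro x hx hne hx'
    apply hne
    have hx2 : x ∈ PointedCone.hull ℝ (w '' Set.Iic i) := hx
    have hx3 : -x ∈ PointedCone.hull ℝ (w '' Set.Iic i) := hx'
    obtain ⟨c, h1, h2, rfl⟩ := PointedCone.mem_hull_image_iff.1 hx2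
    refine Finset.sum_eq_zero fun j _ => ?_
    obtain ⟨f, hf⟩ := hw.exists_coord j
    have h3 := PointedCone.map_nonneg_of_mem_hull (f := f)
      (by rintro _ ⟨k, -, rfl⟩; rw [hf]; split_ifs <;> norm_num) hx3
    have h4 : f (∑ j, c j • w j) = c j := by simp [hf]
    rw [map_neg, h4] at h3
    rw [le_antisymm (by linarith) (h1 j), zero_smul]
  dim i := by
    have h1 : Submodule.span ℝ (PointedCone.hull ℝ (w '' Set.Iic i) : Set V) =
        Submodule.span ℝ (w '' Set.Iic i) :=
      le_antisymm (Submodule.span_le.2 (PointedCone.hull_le_span ℝ _))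
        (Submodule.span_mono PointedCone.subset_hull)
    have h2 : w '' Set.Iic i = Set.range (w ∘ ((↑) : Set.Iic i → Fin ℓ)) := by
      rw [Set.range_comp, Subtype.range_coe]
    rw [h1, h2, finrank_span_eq_card (hw.comp _ Subtype.val_injective)]
    exact (Fintype.card_of_finset' (Finset.Iic i) (by simp)).trans (Fin.card_Iic i)
  face i j hij := by
    refine ⟨Submodule.span_mono (Set.image_mono (Set.Iic_subset_Iic.2 hij)),
      fun {x y a} hx hy ha h => ?_⟩
    obtain ⟨c, h1, h2, rfl⟩ := PointedCone.mem_hull_image_iff.1 hx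
    refine PointedCone.mem_hull_image_iff.2 ⟨c, h1, fun k hk => ?_, rfl⟩
    -- For `k` outside the smaller segment, the `k`-th coordinate is nonnegative on `x` and `y` and
    -- nonpositive on `a • x + y`, hence zero on `x`.
    obtain ⟨f, hf⟩ := hw.exists_coord k
    have h3 := PointedCone.map_nonneg_of_mem_hull (f := f)
      (by rintro _ ⟨k, -, rfl⟩; rw [hf]; split_ifs <;> norm_num) hy
    have h4 := PointedCone.map_nonneg_of_mem_hull (f := -f) (by
      rintro _ ⟨m, hm, rfl⟩
      rw [LinearMap.neg_apply, hf, if_neg (by rintro rfl; exact hk hm), neg_zero]) h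
    have h5 : f (∑ j, c j • w j) = c k := by simp [hf]
    rw [LinearMap.neg_apply, map_add, map_smul, h5, smul_eq_mul] at h4
    nlinarith [h1 k]

theorem ConeFlag.isSimplicial_ofLinearIndependent (hw : LinearIndependent ℝ w) :
    (ConeFlag.ofLinearIndependent hw).IsSimplicial := fun i =>
  ⟨w '' Set.Iic i, (Set.toFinite _).image _, hw.linearIndepOn_id.mono (Set.image_subset_range _ _),
    rfl⟩

theorem ConeFlag.isChoice_ofLinearIndependent (hw : LinearIndependent ℝ w) :
    (ConeFlag.ofLinearIndependent hw).IsChoice w := by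
  have key : ∀ i j : Fin ℓ, j < i → w i ∉ PointedCone.hull ℝ (w '' Set.Iic j) := by
    intro i j hj hmem
    obtain ⟨f, hf⟩ := hw.exists_coord i
    have h := PointedCone.map_nonneg_of_mem_hull (f := -f) (by
        rintro _ ⟨m, hm, rfl⟩
        rw [LinearMap.neg_apply, hf, if_neg (by rintro rfl; exact absurd hm (not_le.2 hj)),
          neg_zero]) hmem
    rw [LinearMap.neg_apply, hf, if_pos rfl] at h
    linarith
  exact fun i => ⟨Submodule.subset_span ⟨i, Set.mem_Iic.2 le_rfl, rfl⟩, hw.ne_zero i, key i⟩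

end FlagOfFamily

/-! ### Prime congruences on `𝔹[M]` -/

theorem BoolSF.eq_one_of_ne_zero {a : BoolSF} (ha : a ≠ 0) : a = 1 := by
  induction a using WithBot.recBotCoe with
  | bot => exact absurd rfl ha
  | coe a => rfl

theorem MaxPlus.add_eq_right_iff {Γ : Type*} [AddCommGroup Γ] [LinearOrder Γ]
    [IsOrderedAddMonoid Γ] {a b : MaxPlus Γ} :
    a + b = b ↔ (show WithBot Γ from a) ≤ (show WithBot Γ from b) :=
  max_eq_right_iff (α := WithBot Γ)

theorem MaxPlus.mul_left_cancel {Γ : Type*} [AddCommGroup Γ] [LinearOrder Γ]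
    [IsOrderedAddMonoid Γ] {a b c : MaxPlus Γ} (ha : a ≠ 0) (h : a * b = a * c) : b = c := by
  induction a using WithBot.recBotCoe with
  | bot => exact absurd rfl ha
  | coe a => exact (WithBot.add_left_inj (WithBot.coe_ne_bot (a := a))).1 h

/-- The quotient embeds in `MaxPlus Γ`, which is totally ordered and cancellative. -/
theorem isPrimeCong_ker {R Γ : Type*} [CommSemiring R] [AddCommGroup Γ] [LinearOrder Γ]
    [IsOrderedAddMonoid Γ] (f : R →+* MaxPlus Γ) : IsPrimeCong (RingCon.ker f) := by
  refine ⟨fun h => ?_, fun a b => ?_, fun a b c => ?_⟩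
  · have h01 : RingCon.ker f 0 1 := by rw [h]; trivial
    rw [RingCon.ker_apply, map_zero, map_one] at h01
    exact WithBot.bot_ne_coe (α := Γ) h01
  · obtain ⟨a, rfl⟩ := Quotient.exists_rep a
    obtain ⟨b, rfl⟩ := Quotient.exists_rep b
    change ((a : (RingCon.ker f).Quotient) + b = b) ∨ ((b : (RingCon.ker f).Quotient) + a = a)
    rw [← RingCon.coe_add, ← RingCon.coe_add, RingCon.eq, RingCon.eq, RingCon.ker_apply,
      RingCon.ker_apply, map_add, map_add, MaxPlus.add_eq_right_iff, MaxPlus.add_eq_right_iff]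
    exact le_total _ _
  · obtain ⟨a, rfl⟩ := Quotient.exists_rep a
    obtain ⟨b, rfl⟩ := Quotient.exists_rep b
    obtain ⟨c, rfl⟩ := Quotient.exists_rep c
    change (a : (RingCon.ker f).Quotient) ≠ 0 → (a : (RingCon.ker f).Quotient) * b = a * c →
      (b : (RingCon.ker f).Quotient) = c
    rw [← RingCon.coe_mul, ← RingCon.coe_mul, ← RingCon.coe_zero, Ne, RingCon.eq, RingCon.eq,
      RingCon.eq, RingCon.ker_apply, RingCon.ker_apply, RingCon.ker_apply, map_mul, map_mul,
      map_zero]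
    exact MaxPlus.mul_left_cancel

theorem IsPrimeCong.add_rel_or {R : Type*} [CommSemiring R] {P : RingCon R} (hP : IsPrimeCong P)
    (a b : R) : P.LeMod a b ∨ P.LeMod b a := by
  have h := hP.total a b
  rwa [← RingCon.coe_add, ← RingCon.coe_add, RingCon.eq, RingCon.eq] at h

section LeMod

variable {R : Type*} [CommSemiring R] {P : RingCon R} {a b c : R}

theorem RingCon.LeMod.trans (h : P.LeMod a b) (h' : P.LeMod b c) : P.LeMod a c := by
  have h1 : P (a + c) (a + b + c) := by
    rw [add_assoc]; exact P.add (P.refl a) (P.symm h')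
  exact P.trans h1 (P.trans (P.add h (P.refl c)) h')

theorem RingCon.LeMod.add (h : P.LeMod a c) (h' : P.LeMod b c) : P.LeMod (a + b) c := by
  have h1 : P (a + b + c) (a + c) := by
    rw [add_assoc]; exact P.add (P.refl a) h'
  exact P.trans h1 h

theorem RingCon.LeMod.mul_left (d : R) (h : P.LeMod a b) : P.LeMod (d * a) (d * b) := by
  rw [RingCon.LeMod, ← mul_add]
  exact P.mul (P.refl d) h

theorem RingCon.LeMod.antisymm (h : P.LeMod a b) (h' : P.LeMod b a) : P a b := by
  rw [RingCon.LeMod, add_comm] at h'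
  exact P.trans (P.symm h') h

end LeMod

/-! ### Maximal exponents and the total submonoid of a prime congruence. -/

section BoolPoly

variable {M : Type*} [AddCommGroup M]

/-- The monomial `χ^u` in `𝔹[M]`. -/
abbrev boolMonomial (u : M) : BoolPoly M := AddMonoidAlgebra.single u 1

theorem leMod_boolMonomial_iff_add {P : RingCon (BoolPoly M)} (u v w : M) :
    P.LeMod (boolMonomial (w + u)) (boolMonomial (w + v)) ↔
      P.LeMod (boolMonomial u) (boolMonomial v) := by
  constructor
  · intro h
    simpa [AddMonoidAlgebra.single_mul_single] using h.mul_left (boolMonomial (-w))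
  · intro h
    simpa [AddMonoidAlgebra.single_mul_single] using h.mul_left (boolMonomial w)

theorem BoolPoly.add_boolMonomial {f : BoolPoly M} {u : M} (hu : u ∈ f.coeff.support) :
    f + boolMonomial u = f := by
  have h1 : f.coeff u = 1 := BoolSF.eq_one_of_ne_zero (Finsupp.mem_support_iff.1 hu)
  ext v
  rw [AddMonoidAlgebra.coeff_add, Finsupp.add_apply, AddMonoidAlgebra.coeff_single]
  by_cases hv : u = v
  · subst hv
    rw [Finsupp.single_eq_same, h1]
    rfl
  · rw [Finsupp.single_eq_of_ne' hv, add_zero]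

theorem BoolPoly.eq_sum {N : Type*} (f : BoolPoly N) :
    f = ∑ u ∈ f.coeff.support, boolMonomial u := by
  conv_lhs => rw [← AddMonoidAlgebra.sum_coeff_single f]
  exact Finset.sum_congr rfl fun u hu => by
    rw [BoolSF.eq_one_of_ne_zero (Finsupp.mem_support_iff.1 hu)]

theorem boolMonomial_leMod_self {P : RingCon (BoolPoly M)} (u : M) :
    P.LeMod (boolMonomial u) (boolMonomial u) := by
  rw [RingCon.LeMod, BoolPoly.add_boolMonomial]
  · exact P.refl _
  · rw [Finsupp.mem_support_iff, AddMonoidAlgebra.coeff_single, Finsupp.single_eq_same]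
    exact WithBot.coe_ne_bot

/-- The elements `u` with `χ^u ≤_P 1`. -/
def PrimeCong.toTotal (P : PrimeCong (BoolPoly M)) : TotalSubmonoid M :=
  ⟨{ carrier := {u | P.1.LeMod (boolMonomial u) (boolMonomial 0)}
     zero_mem' := boolMonomial_leMod_self 0
     add_mem' := fun {u v} hu hv => by
      have h := (leMod_boolMonomial_iff_add v 0 u).2 hv
      rw [add_zero] at h
      exact h.trans hu }, fun u => by
    refine (P.2.add_rel_or (boolMonomial u) (boolMonomial 0)).imp id fun h => ?_
    have := (leMod_boolMonomial_iff_add 0 u (-u)).2 h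
    simpa using this⟩

theorem PrimeCong.sub_mem_toTotal (P : PrimeCong (BoolPoly M)) {u v : M} :
    u - v ∈ P.toTotal.1 ↔ P.1.LeMod (boolMonomial u) (boolMonomial v) := by
  rw [← leMod_boolMonomial_iff_add u v (-v), neg_add_cancel, neg_add_eq_sub]
  rfl

theorem TotalSubmonoid.exists_max (S : TotalSubmonoid M) {t : Finset M} (ht : t.Nonempty) :
    ∃ u ∈ t, ∀ v ∈ t, v - u ∈ S.1 := by
  classical
  induction ht using Finset.Nonempty.cons_induction with
  | singleton a => exact ⟨a, by simp⟩
  | cons a t ha _ ih =>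
    obtain ⟨u, hu, h⟩ := ih
    rcases S.2 (a - u) with hau | hau
    · exact ⟨u, by simp [hu], by simpa [hau] using h⟩
    · refine ⟨a, by simp, fun v hv => ?_⟩
      rcases Finset.mem_cons.1 hv with rfl | hv
      · simp
      · convert S.1.add_mem (h v hv) hau using 1; abel

/-- All nonzero coefficients are `1`, so `f` is a sum of monomials `≤ χ^u`. Conversely `f + χ^u = f`
by idempotence. -/
theorem PrimeCong.rel_boolMonomial_of_max (P : PrimeCong (BoolPoly M)) {f : BoolPoly M} {u : M}
    (hu : u ∈ f.coeff.support) (h : ∀ v ∈ f.coeff.support, v - u ∈ P.toTotal.1) :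
    P.1 f (boolMonomial u) := by
  classical
  have key : ∀ t : Finset M, (∀ v ∈ t, v - u ∈ P.toTotal.1) →
      P.1.LeMod (∑ v ∈ t, boolMonomial v) (boolMonomial u) := by
    intro t
    induction t using Finset.induction_on with
    | empty => intro _; simpa [RingCon.LeMod] using P.1.refl _
    | insert a t ha ih =>
      intro ht
      rw [Finset.sum_insert ha]
      exact (P.sub_mem_toTotal.1 (ht a (by simp))).add (ih fun v hv => ht v (by simp [hv]))
  have := key _ h
  rwa [← BoolPoly.eq_sum, RingCon.LeMod, BoolPoly.add_boolMonomial hu] at this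

theorem PrimeCong.exists_max (P : PrimeCong (BoolPoly M)) {f : BoolPoly M} (hf : f ≠ 0) :
    ∃ u ∈ f.coeff.support, (∀ v ∈ f.coeff.support, v - u ∈ P.toTotal.1) ∧
      P.1 f (boolMonomial u) := by
  obtain ⟨u, hu, h⟩ := P.toTotal.exists_max (t := f.coeff.support)
    (Finsupp.support_nonempty_iff.2 (by simpa using hf))
  exact ⟨u, hu, h, P.rel_boolMonomial_of_max hu h⟩

/-- A nonzero `f` is congruent to a monomial, which is a unit. If it were congruent to `0`, so would
be `1`, and the congruence would be improper. -/
theorem PrimeCong.eq_zero_of_rel_zero (P : PrimeCong (BoolPoly M)) {f : BoolPoly M}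
    (h : P.1 f 0) : f = 0 := by
  by_contra hf
  obtain ⟨u, -, -, hu⟩ := P.exists_max hf
  have h1 : P.1 (boolMonomial 0) 0 := by
    simpa [AddMonoidAlgebra.single_mul_single] using
      P.1.mul (P.1.refl (boolMonomial (-u))) (P.1.trans (P.1.symm hu) h)
  refine P.2.proper (eq_top_iff.2 fun x y _ => ?_)
  have hx : ∀ x, P.1 x 0 := fun x => by
    simpa [boolMonomial, ← AddMonoidAlgebra.one_def] using P.1.mul h1 (P.1.refl x)
  exact P.1.trans (hx x) (P.1.symm (hx y))

/-- For nonzero `f`, `g` with maximal exponents `u`, `v`, congruence means equivalence of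
`u` and `v`. -/
theorem PrimeCong.rel_iff (P : PrimeCong (BoolPoly M)) {f g : BoolPoly M} {u v : M}
    (hu : u ∈ f.coeff.support) (hu' : ∀ a ∈ f.coeff.support, a - u ∈ P.toTotal.1)
    (hv : v ∈ g.coeff.support) (hv' : ∀ a ∈ g.coeff.support, a - v ∈ P.toTotal.1) :
    P.1 f g ↔ u - v ∈ P.toTotal.1 ∧ v - u ∈ P.toTotal.1 := by
  have h1 := P.rel_boolMonomial_of_max hu hu'
  have h2 := P.rel_boolMonomial_of_max hv hv'
  rw [P.sub_mem_toTotal, P.sub_mem_toTotal]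
  constructor
  · intro h
    have h3 : P.1 (boolMonomial u) (boolMonomial v) := P.1.trans (P.1.symm h1) (P.1.trans h h2)
    exact ⟨P.1.trans (P.1.add h3 (P.1.refl _)) (boolMonomial_leMod_self v),
      P.1.trans (P.1.add (P.1.symm h3) (P.1.refl _)) (boolMonomial_leMod_self u)⟩
  · rintro ⟨h3, h4⟩
    exact P.1.trans h1 (P.1.trans (h3.antisymm h4) (P.1.symm h2))

theorem PrimeCong.toTotal_injective :
    Function.Injective (PrimeCong.toTotal : PrimeCong (BoolPoly M) → TotalSubmonoid M) := by
  have key : ∀ P Q : PrimeCong (BoolPoly M), P.toTotal = Q.toTotal → ∀ f g, P.1 f g → Q.1 f g := by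
    intro P Q h f g hfg
    by_cases hf : f = 0
    · rw [hf] at hfg
      rw [hf, P.eq_zero_of_rel_zero (P.1.symm hfg)]
      exact Q.1.refl 0
    by_cases hg : g = 0
    · exact absurd (P.eq_zero_of_rel_zero (hg ▸ hfg)) hf
    obtain ⟨u, hu, hu', -⟩ := P.exists_max hf
    obtain ⟨v, hv, hv', -⟩ := P.exists_max hg
    rw [P.rel_iff hu hu' hv hv'] at hfg
    rw [h] at hu' hv' hfg
    exact (Q.rel_iff hu hu' hv hv').2 hfg
  exact fun P Q h => Subtype.ext (RingCon.ext fun f g => ⟨key P Q h f g, key Q P h.symm f g⟩)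

/-- The inclusion of the Boolean semifield into `MaxPlus Γ`. -/
def boolToMaxPlus (Γ : Type*) [AddCommGroup Γ] [LinearOrder Γ] [IsOrderedAddMonoid Γ] :
    BoolSF →+* MaxPlus Γ where
  toFun a := WithBot.map (α := Unit) (fun _ => (0 : Γ)) a
  map_zero' := rfl
  map_one' := rfl
  map_add' a b := Monotone.map_max (α := WithBot Unit) (β := WithBot Γ)
    (WithBot.monotone_map_iff.2 fun _ _ _ => le_rfl)
  map_mul' a b := by
    induction a using WithBot.recBotCoe with
    | bot => rfl
    | coe a =>
      induction b using WithBot.recBotCoe with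
      | bot => rfl
      | coe b => exact congrArg (WithBot.some (α := Γ)) (zero_add (0 : Γ)).symm

/-- The homomorphism `𝔹[M] → MaxPlus Γ` which extends a homomorphism `M → Γ`. -/
def boolPolyToMaxPlus {Γ : Type*} [AddCommGroup Γ] [LinearOrder Γ] [IsOrderedAddMonoid Γ]
    (x : M →+ Γ) : BoolPoly M →+* MaxPlus Γ :=
  AddMonoidAlgebra.liftNCRingHom (boolToMaxPlus Γ)
    { toFun := fun u => (WithBot.some (x u.toAdd) : WithBot Γ)
      map_one' := congrArg (WithBot.some (α := Γ)) x.map_zero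
      map_mul' := fun u v => congrArg (WithBot.some (α := Γ)) (x.map_add u.toAdd v.toAdd) }
    fun _ _ => Commute.all _ _

theorem boolPolyToMaxPlus_boolMonomial {Γ : Type*} [AddCommGroup Γ] [LinearOrder Γ]
    [IsOrderedAddMonoid Γ] (x : M →+ Γ) (u : M) :
    boolPolyToMaxPlus x (boolMonomial u) = (WithBot.some (x u) : WithBot Γ) := by
  rw [boolPolyToMaxPlus, boolMonomial, AddMonoidAlgebra.liftNCRingHom_single, map_one, one_mul]
  rfl

theorem toLex_le_iff {ℓ : ℕ} {a b : Fin ℓ → ℝ} :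
    toLex a ≤ toLex b ↔ ¬ LexPos fun i => a i - b i := by
  rw [← not_lt, not_iff_not]
  refine exists_congr fun i => and_congr (forall₂_congr fun j _ => ?_) ?_
  · rw [sub_eq_zero]
    exact eq_comm
  · rw [sub_pos]
    exact Iff.rfl

/-- Present `S` lexicographically; the resulting homomorphism from `M` to the lexicographic `ℝ^ℓ`
extends to `𝔹[M]`, and its kernel is the required congruence. -/
theorem PrimeCong.toTotal_surjective [AddGroup.FG M] [Module.Finite ℝ (NR M)] :
    Function.Surjective (PrimeCong.toTotal : PrimeCong (BoolPoly M) → TotalSubmonoid M) := by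
  intro S
  obtain ⟨ℓ, x, -, hx⟩ := S.exists_lex
  let y : M →+ Lex (Fin ℓ → ℝ) :=
    { toFun := fun u => toLex fun i => x i u
      map_zero' := by
        have : (fun i => x i 0) = (0 : Fin ℓ → ℝ) := funext fun i => map_zero _
        exact congrArg toLex this
      map_add' := fun u v => by
        have : (fun i => x i (u + v)) = (fun i => x i u) + fun i => x i v :=
          funext fun i => map_add _ _ _
        exact congrArg toLex this }
  refine ⟨⟨_, isPrimeCong_ker (boolPolyToMaxPlus y)⟩, Subtype.ext (AddSubmonoid.ext fun u => ?_)⟩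
  have h1 : boolPolyToMaxPlus y (boolMonomial u + boolMonomial 0) =
      boolPolyToMaxPlus y (boolMonomial 0) ↔ y u ≤ y 0 := by
    rw [map_add, boolPolyToMaxPlus_boolMonomial, boolPolyToMaxPlus_boolMonomial]
    exact MaxPlus.add_eq_right_iff.trans WithBot.coe_le_coe
  rw [hx]
  refine h1.trans (toLex_le_iff.trans ?_)
  simp

/-- Prime congruences on `𝔹[M]` correspond to total submonoids of `M`. -/
def primeCongEquiv (M : Type*) [AddCommGroup M] [AddGroup.FG M] [Module.Finite ℝ (NR M)] :
    PrimeCong (BoolPoly M) ≃ TotalSubmonoid M :=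
  Equiv.ofBijective _ ⟨PrimeCong.toTotal_injective, PrimeCong.toTotal_surjective⟩

end BoolPoly

/-! ### Monomial preorders -/

section Preorder

variable {M A : Type*} [AddCommGroup M] [CommMonoid A]

/-- The monomial preorder defined by a total submonoid. -/
def TotalSubmonoid.toPreorder (φ : Multiplicative M ≃* A) (S : TotalSubmonoid M) :
    MonomialPreorder A where
  le a b := (φ.symm a).toAdd - (φ.symm b).toAdd ∈ S.1
  total a b := by simpa using S.2 ((φ.symm a).toAdd - (φ.symm b).toAdd)
  trans a b c h h' := by simpa using S.1.add_mem h h'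
  mul_right a b c h := by simpa using h

/-- Monomial preorders correspond to total submonoids. -/
def totalSubmonoidEquivPreorder (φ : Multiplicative M ≃* A) :
    TotalSubmonoid M ≃ MonomialPreorder A :=
  Equiv.ofBijective (TotalSubmonoid.toPreorder φ) (by
    constructor
    · intro S T h
      refine Subtype.ext (AddSubmonoid.ext fun u => ?_)
      have := congrArg (fun Q => Q.le (φ (.ofAdd u)) 1) h
      simpa [TotalSubmonoid.toPreorder] using this
    · intro Q
      -- Monomials are invertible, so every comparison can be translated to a comparison with `1`.
      have hmul : ∀ a b : A, Q.le a b ↔ Q.le (φ (φ.symm a / φ.symm b)) 1 := by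
        intro a b
        have h1 : a * φ (φ.symm b)⁻¹ = φ (φ.symm a / φ.symm b) := by
          rw [div_eq_mul_inv, map_mul, φ.apply_symm_apply]
        have h2 : b * φ (φ.symm b)⁻¹ = 1 := by
          conv_lhs => rw [← φ.apply_symm_apply b, φ.symm_apply_apply, ← map_mul, mul_inv_cancel,
            map_one]
        have h3 : φ (φ.symm a / φ.symm b) * b = a := by
          conv_lhs => rw [← h1, mul_assoc, mul_comm _ b, h2, mul_one]
        constructor
        · intro h
          simpa only [h1, h2] using Q.mul_right _ _ (φ (φ.symm b)⁻¹) h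
        · intro h
          simpa only [h3, one_mul] using Q.mul_right _ _ b h
      refine ⟨⟨{ carrier := {u | Q.le (φ (.ofAdd u)) 1}
                 zero_mem' := ?_
                 add_mem' := fun {u v} hu hv => ?_ }, fun u => ?_⟩, ?_⟩
      · have := Q.mul_right _ _ (φ (.ofAdd v)) hu
        rw [one_mul, ← map_mul, ← ofAdd_add] at this
        exact Q.trans _ _ _ this hv
      · have := Q.total 1 1
        simpa using this
      · refine (Q.total (φ (.ofAdd u)) 1).imp id fun h => ?_
        have := (hmul _ _).1 h
        simpa using this
      · ext a b
        rw [hmul a b]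
        rfl)

end Preorder

/-- The isomorphism between `M` and the monoid of Laurent monomials. -/
def laurentMonomialEquiv {M : Type*} [AddCommGroup M] {n : ℕ} (e : M ≃+ (Fin n → ℤ))
    (k : Type*) [CommRing k] [Nontrivial k] : Multiplicative M ≃* LaurentMonomials k n :=
  e.toMultiplicative.trans (MulEquiv.ofBijective (AddMonoidAlgebra.of k (Fin n → ℤ)).mrangeRestrict
    ⟨fun _ _ h => AddMonoidAlgebra.of_injective (congrArg Subtype.val h),
      MonoidHom.mrangeRestrict_surjective _⟩)

theorem laurentMonomialEquiv_symm {M : Type*} [AddCommGroup M] {n : ℕ} (e : M ≃+ (Fin n → ℤ))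
    (k : Type*) [CommRing k] [Nontrivial k] (u : Fin n → ℤ) :
    (laurentMonomialEquiv e k).symm (laurentMonomial k u) = .ofAdd (e.symm u) := by
  rw [MulEquiv.symm_apply_eq]
  refine Subtype.ext ?_
  change _ = AddMonoidAlgebra.of k (Fin n → ℤ) (.ofAdd (e (e.symm u)))
  rw [e.apply_symm_apply]
  rfl

/-! ### Flags of cones and total submonoids -/

theorem LexPos.or_of_add {ℓ : ℕ} {a b : Fin ℓ → ℝ} (h : LexPos (a + b)) : LexPos a ∨ LexPos b := by
  by_contra! hab
  have ha : toLex a ≤ toLex 0 := toLex_le_iff.2 (by simpa using hab.1)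
  have hb : toLex b ≤ toLex 0 := toLex_le_iff.2 (by simpa using hab.2)
  have : toLex (a + b) ≤ toLex 0 := add_nonpos ha hb
  exact toLex_le_iff.1 this (by simpa [Pi.add_def] using h)

section Flags

variable {M : Type*} [AddCommGroup M]

/-- The elements of `M` which are nonpositive for the lexicographic order defined by `x`. -/
def lexTotal {ℓ : ℕ} (x : Fin ℓ → NR M) : TotalSubmonoid M :=
  ⟨{ carrier := {u | ¬ LexPos fun i => x i u}
     zero_mem' := by simp [LexPos]
     add_mem' := fun {u v} hu hv h => by
      have h' : LexPos ((fun i => x i u) + fun i => x i v) := by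
        convert h using 1
        ext i
        simp
      exact h'.or_of_add.elim hu hv }, fun u => by
    by_contra! h
    simp only [AddSubmonoid.mem_mk, AddSubsemigroup.mem_mk, Set.mem_ofPred_eq, not_not] at h
    exact h.1.not_neg (by simpa using h.2)⟩

/-- Evaluation at `u` as a linear functional on `N_ℝ`. -/
def NR.eval (u : M) : NR M →ₗ[ℝ] ℝ := (LinearMap.proj u).comp (NR.coeLin M)

@[simp]
theorem NR.eval_apply (u : M) (x : NR M) : NR.eval u x = x u := rfl

/-- Finitely many elements in `S` and outside of `S` can be separated by a point of `N_ℝ`. -/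
theorem TotalSubmonoid.exists_separating [AddGroup.FG M] [Module.Finite ℝ (NR M)]
    (S : TotalSubmonoid M) {s t : Set M} (hs : s.Finite) (ht : t.Finite) (hsS : ∀ u ∈ s, u ∈ S.1)
    (htS : ∀ u ∈ t, u ∉ S.1) : ∃ x : NR M, (∀ u ∈ s, x u ≤ 0) ∧ ∀ u ∈ t, 0 < x u := by
  obtain ⟨ℓ, w, -, hw⟩ := S.exists_lex
  obtain ⟨ε, -, h⟩ := exists_pos_forall_sign w (s ∪ t) (hs.union ht)
    (fun u => (NR.eval u).toAddMonoidHom) (fun u c x => rfl)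
  exact ⟨_, fun u hu => (h u (Or.inl hu)).2 ((hw u).1 (hsS u hu)),
    fun u hu => (h u (Or.inr hu)).1 (not_not.1 fun h' => htS u hu ((hw u).2 h'))⟩

variable [Module.Finite ℝ (NR M)]

theorem ConeFlag.exists_isChoice {V : Type*} [AddCommGroup V] [Module ℝ V] (F : ConeFlag V) :
    ∃ w, F.IsChoice w := by
  have : ∀ i, ∃ w, w ∈ F.cone i ∧ w ∉ F.pred i := fun i => by
    by_contra! h
    have h1 := le_antisymm h (F.pred_isFaceOf i).le
    have h2 := F.dim i
    rw [h1, finrank_span_pred] at h2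
    omega
  choose w hw using this
  exact ⟨w, (F.isChoice_iff w).2 hw⟩

/-- The elements of `M` which are nonpositive for the lexicographic order defined by a flag. -/
def ConeFlag.toTotal (C : ConeFlag (NR M)) : TotalSubmonoid M :=
  lexTotal C.exists_isChoice.choose

theorem ConeFlag.mem_toTotal (C : ConeFlag (NR M)) {w : Fin C.length → NR M} (hw : C.IsChoice w)
    {u : M} : u ∈ C.toTotal.1 ↔ ¬ LexPos fun i => w i u :=
  not_congr ⟨C.map_pos_iff C.exists_isChoice.choose_spec hw (NR.eval u),
    C.map_pos_iff hw C.exists_isChoice.choose_spec (NR.eval u)⟩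

theorem ConeFlag.isNbhd_rational_iff (C : ConeFlag (NR M)) (s : Finset M) :
    C.IsNbhd {x | ∀ u ∈ s, x u ≤ 0} ↔ ∀ u ∈ s, u ∈ C.toTotal.1 := by
  obtain ⟨w, hw⟩ := C.exists_isChoice
  have h := C.isNbhd_iff hw (S := NR.eval '' (s : Set M)) (s.finite_toSet.image _)
  simp only [Set.forall_mem_image, NR.eval_apply] at h
  exact h.trans (forall₂_congr fun u _ => (C.mem_toTotal hw).symm)

/-- A half space is a neighborhood exactly when its normal lies in the total submonoid, and a
rational cone is a finite intersection of half spaces. -/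
theorem ratLocEquiv_iff {C C' : ConeFlag (NR M)} :
    ratLocEquiv M C C' ↔ C.toTotal = C'.toTotal := by
  constructor
  · intro h
    refine Subtype.ext (AddSubmonoid.ext fun u => ?_)
    have := h _ ⟨{u}, rfl⟩
    rw [C.isNbhd_rational_iff, C'.isNbhd_rational_iff] at this
    simpa using this
  · rintro h _ ⟨s, rfl⟩
    rw [C.isNbhd_rational_iff, C'.isNbhd_rational_iff, h]

/-- Local equivalence classes of flags correspond to total submonoids. -/
def flagEquiv (M : Type*) [AddCommGroup M] [AddGroup.FG M] [Module.Finite ℝ (NR M)] :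
    Quotient (ratLocEquiv M) ≃ TotalSubmonoid M :=
  Equiv.ofBijective (Quotient.lift ConeFlag.toTotal fun _ _ h => ratLocEquiv_iff.1 h) (by
    constructor
    · intro a b
      induction a using Quotient.inductionOn
      induction b using Quotient.inductionOn
      exact fun h => Quotient.sound (ratLocEquiv_iff.2 h)
    · intro S
      obtain ⟨ℓ, x, hx, hS⟩ := S.exists_lex
      refine ⟨Quotient.mk _ (ConeFlag.ofLinearIndependent hx),
        Subtype.ext (AddSubmonoid.ext fun u => ?_)⟩
      rw [hS]
      exact ConeFlag.mem_toTotal _ (ConeFlag.isChoice_ofLinearIndependent hx))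

end Flags

/-! ### Prime filters and total submonoids -/

namespace PrimeFilter

variable {L : Type*} [Lattice L]

/-- Constructor for prime filters. -/
def ofSet (F : Set L) (hne : F.Nonempty) (hup : ∀ a b, a ≤ b → a ∈ F → b ∈ F)
    (hinf : ∀ a b, a ∈ F → b ∈ F → a ⊓ b ∈ F) (hproper : ∃ a, a ∉ F)
    (hsup : ∀ a b, a ⊔ b ∈ F → a ∈ F ∨ b ∈ F) : PrimeFilter L :=
  ⟨(Order.IsPFilter.of_def (F := F) hne
      (fun a ha b hb => ⟨a ⊓ b, hinf a b ha hb, inf_le_left, inf_le_right⟩)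
      fun {a b} h ha => hup a b h ha).toPFilter,
    -- Primality is expressed by the complement being an ideal: a nonempty lower set that is
    -- directed.
    ⟨⟨fun a b h ha hb => ha (hup b a h hb), hproper,
      fun a ha b hb => ⟨a ⊔ b, fun h => (hsup a b h).elim ha hb, le_sup_left, le_sup_right⟩⟩⟩⟩

theorem mem_or_mem (F : PrimeFilter L) {a b : L} (h : a ⊔ b ∈ F.1) : a ∈ F.1 ∨ b ∈ F.1 := by
  by_contra! hab
  obtain ⟨c, hc, hac, hbc⟩ := F.2.compl_ideal.Directed a hab.1 b hab.2
  exact hc (Order.PFilter.mem_of_le (sup_le hac hbc) h)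

theorem exists_notMem (F : PrimeFilter L) : ∃ a, a ∉ F.1 := F.2.compl_ideal.Nonempty

end PrimeFilter

section FanSupport

variable {V : Type*} {𝒜 : Set (Set V)} {h𝒜 : InfClosed 𝒜}

/-- A member of `𝒜` as a fan support set. -/
def fanCone (h𝒜 : InfClosed 𝒜) {D : Set V} (hD : D ∈ 𝒜) : fanSupportLattice 𝒜 h𝒜 :=
  ⟨D, {D}, Set.finite_singleton D, Set.singleton_subset_iff.2 hD, (Set.sUnion_singleton D).symm⟩

/-- The empty fan support set. -/
def fanEmpty (h𝒜 : InfClosed 𝒜) : fanSupportLattice 𝒜 h𝒜 :=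
  ⟨∅, ∅, Set.finite_empty, Set.empty_subset _, Set.sUnion_empty.symm⟩

theorem PrimeFilter.fanEmpty_notMem (F : PrimeFilter (fanSupportLattice 𝒜 h𝒜)) :
    fanEmpty h𝒜 ∉ F.1 := fun h => by
  obtain ⟨a, ha⟩ := F.exists_notMem
  exact ha (Order.PFilter.mem_of_le (Set.empty_subset (a : Set V)) h)

/-- Primality selects one cone from a finite union, and the empty union is excluded by properness. A
prime filter is thus determined by its cones. -/
theorem PrimeFilter.mem_iff_exists_fanCone (F : PrimeFilter (fanSupportLattice 𝒜 h𝒜))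
    (U : fanSupportLattice 𝒜 h𝒜) :
    U ∈ F.1 ↔ ∃ (D : Set V) (hD : D ∈ 𝒜), fanCone h𝒜 hD ∈ F.1 ∧ D ⊆ U := by
  refine ⟨fun hU => ?_, fun ⟨D, hD, hDF, hDU⟩ => Order.PFilter.mem_of_le (by exact hDU) hDF⟩
  obtain ⟨U, A, hA, hA𝒜, rfl⟩ := U
  induction A, hA using Set.Finite.induction_on with
  | empty =>
    refine absurd ?_ F.fanEmpty_notMem
    convert hU using 1
    exact Subtype.ext Set.sUnion_empty.symm
  | @insert D A _ hA ih =>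
    have hD : D ∈ 𝒜 := hA𝒜 (Set.mem_insert D A)
    have hA' : A ⊆ 𝒜 := (Set.subset_insert D A).trans hA𝒜
    have heq : (⟨⋃₀ insert D A, insert D A, hA.insert D, hA𝒜, rfl⟩ : fanSupportLattice 𝒜 h𝒜) =
        fanCone h𝒜 hD ⊔ ⟨⋃₀ A, A, hA, hA', rfl⟩ := Subtype.ext (Set.sUnion_insert D A)
    have hU' : fanCone h𝒜 hD ⊔ ⟨⋃₀ A, A, hA, hA', rfl⟩ ∈ F.1 := heq ▸ hU
    rcases F.mem_or_mem hU' with h | h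
    · exact ⟨D, hD, h, Set.subset_sUnion_of_mem (Set.mem_insert D A)⟩
    · obtain ⟨E, hE, h1, h2⟩ := ih hA' h
      exact ⟨E, hE, h1, h2.trans (Set.sUnion_mono (Set.subset_insert D A))⟩

end FanSupport

section RatFilter

variable {M : Type*} [AddCommGroup M]

/-- The rational cone defined by `s`, as a rational fan support set. -/
def ratCone (s : Finset M) : ratFanLattice M :=
  fanCone (rationalCones_infClosed M) (D := {x | ∀ u ∈ s, x u ≤ 0}) ⟨s, rfl⟩

theorem PrimeFilter.ratCone_mem_iff (F : PrimeFilter (ratFanLattice M)) (s : Finset M) :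
    ratCone s ∈ F.1 ↔ ∀ u ∈ s, ratCone {u} ∈ F.1 := by
  classical
  constructor
  · intro h u hu
    refine Order.PFilter.mem_of_le (x := ratCone s) (fun x (hx : ∀ u ∈ s, x u ≤ 0) => ?_) h
    change ∀ v ∈ ({u} : Finset M), x v ≤ 0
    simpa using hx u hu
  · intro h
    induction s using Finset.induction_on with
    | empty =>
      obtain ⟨U, hU⟩ := F.1.nonempty
      refine Order.PFilter.mem_of_le (x := U) (fun x _ => ?_) hU
      change ∀ v ∈ (∅ : Finset M), x v ≤ 0
      simp
    | insert u s _ ih =>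
      refine Order.PFilter.mem_of_le (x := ratCone {u} ⊓ ratCone s) ?_ (Order.PFilter.inf_mem
        (h u (by simp)) (ih fun v hv => h v (by simp [hv])))
      rintro x ⟨h1 : ∀ v ∈ ({u} : Finset M), x v ≤ 0, h2 : ∀ v ∈ s, x v ≤ 0⟩ v hv
      rcases Finset.mem_insert.1 hv with rfl | hv
      · exact h1 v (by simp)
      · exact h2 v hv

/-- The elements `u` of `M` whose half space `{x | ⟨x, u⟩ ≤ 0}` belongs to a prime filter. -/
def PrimeFilter.toTotal (F : PrimeFilter (ratFanLattice M)) : TotalSubmonoid M :=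
  ⟨{ carrier := {u | ratCone {u} ∈ F.1}
     zero_mem' := by
      obtain ⟨U, hU⟩ := F.1.nonempty
      refine Order.PFilter.mem_of_le (x := U) (fun x _ => ?_) hU
      change ∀ v ∈ ({0} : Finset M), x v ≤ 0
      simp
     add_mem' := fun {u v} hu hv => by
      refine Order.PFilter.mem_of_le (x := ratCone {u} ⊓ ratCone {v}) ?_
        (Order.PFilter.inf_mem hu hv)
      rintro x ⟨h1 : ∀ a ∈ ({u} : Finset M), x a ≤ 0, h2 : ∀ a ∈ ({v} : Finset M), x a ≤ 0⟩
      change ∀ a ∈ ({u + v} : Finset M), x a ≤ 0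
      simp only [Finset.mem_singleton, forall_eq] at h1 h2 ⊢
      rw [map_add]
      exact add_nonpos h1 h2 }, fun u => by
    obtain ⟨U, hU⟩ := F.1.nonempty
    -- The half spaces of `u` and `-u` cover `N_ℝ`, so primality puts one of them in the filter.
    refine F.mem_or_mem (a := ratCone {u}) (b := ratCone {-u})
      (Order.PFilter.mem_of_le (x := U) (fun x _ => ?_) hU)
    rcases le_total (x u) 0 with h | h
    · left
      change ∀ a ∈ ({u} : Finset M), x a ≤ 0
      simpa using h
    · right
      change ∀ a ∈ ({-u} : Finset M), x a ≤ 0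
      simpa using h⟩

theorem PrimeFilter.mem_iff_toTotal (F : PrimeFilter (ratFanLattice M)) (U : ratFanLattice M) :
    U ∈ F.1 ↔ ∃ s : Finset M, (∀ u ∈ s, u ∈ F.toTotal.1) ∧
      {x : NR M | ∀ u ∈ s, x u ≤ 0} ⊆ (U : Set (NR M)) := by
  rw [F.mem_iff_exists_fanCone]
  constructor
  · rintro ⟨_, ⟨s, rfl⟩, h1, h2⟩
    exact ⟨s, (F.ratCone_mem_iff s).1 h1, h2⟩
  · rintro ⟨s, h1, h2⟩
    exact ⟨_, ⟨s, rfl⟩, (F.ratCone_mem_iff s).2 h1, h2⟩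

variable [AddGroup.FG M] [Module.Finite ℝ (NR M)]

/-- This is what makes the filter of `S` prime. If every `D ∈ A` had a defining inequality with
normal outside `S`, a point separating `s` from these normals would lie in the cone of `s` but in no
`D`. -/
theorem TotalSubmonoid.exists_cone_of_subset_sUnion (S : TotalSubmonoid M) {s : Finset M}
    (hs : ∀ u ∈ s, u ∈ S.1) {A : Set (Set (NR M))} (hA : A.Finite) (hA' : A ⊆ rationalCones M)
    (h : {x : NR M | ∀ u ∈ s, x u ≤ 0} ⊆ ⋃₀ A) :
    ∃ D ∈ A, ∃ t : Finset M, (∀ u ∈ t, u ∈ S.1) ∧ D = {x : NR M | ∀ u ∈ t, x u ≤ 0} := by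
  by_contra! hcon
  have hex : ∀ D : A, ∃ u, u ∉ S.1 ∧ ∀ x ∈ D.1, x u ≤ 0 := by
    rintro ⟨D, hD⟩
    obtain ⟨t, rfl⟩ := hA' hD
    have : ¬ ∀ u ∈ t, u ∈ S.1 := fun h' => hcon _ hD t h' rfl
    push Not at this
    obtain ⟨u, hu, huS⟩ := this
    exact ⟨u, huS, fun x hx => hx u hu⟩
  choose v hv hv' using hex
  have := hA.to_subtype
  obtain ⟨x, hx, hx'⟩ := S.exists_separating s.finite_toSet (Set.finite_range v) hs
    (by rintro _ ⟨D, rfl⟩; exact hv D)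
  obtain ⟨D, hD, hxD⟩ := h hx
  exact absurd (hv' ⟨D, hD⟩ x hxD) (not_le.2 (hx' _ ⟨⟨D, hD⟩, rfl⟩))

/-- The prime filter generated by the half spaces `{x | ⟨x, u⟩ ≤ 0}` with `u ∈ S`. -/
def TotalSubmonoid.toFilter (S : TotalSubmonoid M) : PrimeFilter (ratFanLattice M) :=
  PrimeFilter.ofSet {U | ∃ s : Finset M, (∀ u ∈ s, u ∈ S.1) ∧
      {x : NR M | ∀ u ∈ s, x u ≤ 0} ⊆ (U : Set (NR M))}
    ⟨ratCone ∅, ∅, by simp, le_rfl⟩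
    (fun _ _ hUU' ⟨s, hs, hsU⟩ => ⟨s, hs, hsU.trans hUU'⟩)
    (by
      classical
      rintro U U' ⟨s, hs, hsU⟩ ⟨t, ht, htU⟩
      refine ⟨s ∪ t, fun u hu => (Finset.mem_union.1 hu).elim (hs u) (ht u), fun x hx => ⟨?_, ?_⟩⟩
      · exact hsU fun u hu => hx u (Finset.mem_union_left _ hu)
      · exact htU fun u hu => hx u (Finset.mem_union_right _ hu))
    -- Every rational cone contains the origin, so the empty set is not in the filter.
    ⟨fanEmpty _, fun ⟨_, _, h⟩ => h (a := 0) (fun _ _ => le_rfl)⟩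
    (by
      rintro ⟨U, A, hA, hA', rfl⟩ ⟨U', B, hB, hB', rfl⟩ ⟨s, hs, hsU⟩
      have hsub : {x : NR M | ∀ u ∈ s, x u ≤ 0} ⊆ ⋃₀ (A ∪ B) := by
        rw [Set.sUnion_union]; exact hsU
      obtain ⟨_, hD, t, ht, rfl⟩ := S.exists_cone_of_subset_sUnion hs (hA.union hB)
        (Set.union_subset hA' hB') hsub
      rcases hD with hD | hD
      · exact Or.inl ⟨t, ht, Set.subset_sUnion_of_mem hD⟩
      · exact Or.inr ⟨t, ht, Set.subset_sUnion_of_mem hD⟩)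

/-- Prime filters of rational fan support sets correspond to total submonoids. -/
def filterEquiv (M : Type*) [AddCommGroup M] [AddGroup.FG M] [Module.Finite ℝ (NR M)] :
    PrimeFilter (ratFanLattice M) ≃ TotalSubmonoid M :=
  Equiv.ofBijective PrimeFilter.toTotal (by
    constructor
    · intro F G h
      refine Subtype.ext (SetLike.ext fun U => ?_)
      rw [F.mem_iff_toTotal, G.mem_iff_toTotal, h]
    · intro S
      refine ⟨S.toFilter, Subtype.ext (AddSubmonoid.ext fun u => ⟨?_, fun hu => ?_⟩)⟩
      · rintro ⟨s, hs, hsu⟩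
        by_contra hu
        obtain ⟨x, hx, hx'⟩ := S.exists_separating s.finite_toSet (Set.finite_singleton u) hs
          (by simpa using hu)
        have : x u ≤ 0 := hsu hx u (by simp)
        exact absurd this (not_le.2 (hx' u rfl))
      · exact ⟨{u}, by simpa using hu, le_rfl⟩)

end RatFilter

/-! ### Admissible neighborhoods of flags in `ℝ_{≥0} × N_ℝ` -/

section Admissible

variable {M : Type*} [AddCommGroup M]

/-- The functional `(r, x) ↦ r γ + ⟨x, u⟩` for `p = (γ, u)`. -/
def admFunctional (p : ℝ × M) : ℝ × NR M →ₗ[ℝ] ℝ :=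
  p.1 • LinearMap.fst ℝ ℝ (NR M) + (NR.eval p.2).comp (LinearMap.snd ℝ ℝ (NR M))

theorem admFunctional_apply (p : ℝ × M) (w : ℝ × NR M) :
    admFunctional p w = w.1 * p.1 + w.2 p.2 := by
  simp [admFunctional, mul_comm]

theorem ConeFlag.isChoice_zeroSlice (C : ConeFlag (NR M)) {w : Fin C.length → NR M}
    (hw : C.IsChoice w) : C.zeroSlice.IsChoice fun i => ((0 : ℝ), w i) := by
  intro i
  refine ⟨⟨w i, (hw i).1, rfl⟩, fun h => (hw i).2.1 (congrArg Prod.snd h), ?_⟩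
  rintro j hj ⟨x, hx, hxw⟩
  have : x = w i := congrArg Prod.snd hxw
  exact (hw i).2.2 j hj (this ▸ hx)

theorem ConeFlag.inHalfSpace_zeroSlice (C : ConeFlag (NR M)) : C.zeroSlice.InHalfSpace := by
  rintro i _ ⟨x, -, rfl⟩
  exact le_rfl

variable [Module.Finite ℝ (NR M)]

theorem ConeFlag.isNbhd_admissible_iff (F : ConeFlag (ℝ × NR M)) {w : Fin F.length → ℝ × NR M}
    (hw : F.IsChoice w) (hF : F.InHalfSpace) (s : Finset (ℝ × M)) :
    F.IsNbhd {y | 0 ≤ y.1 ∧ ∀ p ∈ s, y.1 * p.1 + y.2 p.2 ≤ 0} ↔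
      ∀ p ∈ s, ¬ LexPos fun i => (w i).1 * p.1 + (w i).2 p.2 := by
  -- The condition `0 ≤ r` is treated as one more functional, `-r`, which is never lexicographically
  -- positive on a flag in the half space.
  have h := F.isNbhd_iff hw
    (S := insert (-LinearMap.fst ℝ ℝ (NR M)) (admFunctional '' (s : Set (ℝ × M))))
    ((s.finite_toSet.image _).insert _)
  simp only [Set.forall_mem_insert, Set.forall_mem_image, admFunctional_apply,
    LinearMap.neg_apply, LinearMap.fst_apply, neg_nonpos] at h
  refine h.trans (and_iff_right ?_)
  rintro ⟨i, -, hi⟩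
  exact absurd (hF i _ (hw i).1) (by linarith)

theorem ConeFlag.isNbhd_zeroSlice_iff (C : ConeFlag (NR M)) (s : Finset (ℝ × M)) :
    C.zeroSlice.IsNbhd {y | 0 ≤ y.1 ∧ ∀ p ∈ s, y.1 * p.1 + y.2 p.2 ≤ 0} ↔
      ∀ p ∈ s, p.2 ∈ C.toTotal.1 := by
  obtain ⟨w, hw⟩ := C.exists_isChoice
  rw [C.zeroSlice.isNbhd_admissible_iff (C.isChoice_zeroSlice hw) C.inHalfSpace_zeroSlice]
  refine forall₂_congr fun p _ => ?_
  rw [C.mem_toTotal hw]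
  simp only [zero_mul, zero_add]
  rfl

theorem ConeFlag.exists_simplicial_locEquiv_zeroSlice [AddGroup.FG M] (C : ConeFlag (NR M)) :
    ∃ C' : ConeFlag (ℝ × NR M), C'.InHalfSpace ∧ C'.IsSimplicial ∧
      ConeFlag.LocEquiv (admissibleCones M) C.zeroSlice C' := by
  obtain ⟨ℓ, x, hx, hxC⟩ := C.toTotal.exists_lex
  have hli : LinearIndependent ℝ (LinearMap.inr ℝ ℝ (NR M) ∘ x) :=
    hx.map' _ (LinearMap.ker_eq_bot.2 LinearMap.inr_injective)
  have hhalf : (ConeFlag.ofLinearIndependent hli).InHalfSpace := fun i w hw =>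
    PointedCone.map_nonneg_of_mem_hull (f := LinearMap.fst ℝ ℝ (NR M))
      (by rintro _ ⟨j, -, rfl⟩; exact le_rfl) hw
  refine ⟨ConeFlag.ofLinearIndependent hli, hhalf,
    ConeFlag.isSimplicial_ofLinearIndependent hli, ?_⟩
  rintro _ ⟨s, rfl⟩
  rw [C.isNbhd_zeroSlice_iff, ConeFlag.isNbhd_admissible_iff _
    (ConeFlag.isChoice_ofLinearIndependent hli) hhalf]
  refine forall₂_congr fun p _ => ?_
  rw [hxC]
  have heq : (fun i => (LinearMap.inr ℝ ℝ (NR M) (x i)).1 * p.1 +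
      (LinearMap.inr ℝ ℝ (NR M) (x i)).2 p.2) = fun i => x i p.2 := by
    ext i
    simp
  exact not_congr (congrArg LexPos heq.symm).to_iff

/-- Test local equivalence on the half space of `(γ, u)`. On `{0} × C` the constant `γ` drops out,
so the sign on `C'` cannot depend on it either, even where the first coordinates of `w` are nonzero.
-/
theorem ConeFlag.mem_toTotal_iff_of_locEquiv (C : ConeFlag (NR M)) {C' : ConeFlag (ℝ × NR M)}
    (hhalf : C'.InHalfSpace) (h : ConeFlag.LocEquiv (admissibleCones M) C.zeroSlice C')
    {w : Fin C'.length → ℝ × NR M} (hw : C'.IsChoice w) (γ : ℝ) (u : M) :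
    u ∈ C.toTotal.1 ↔ ¬ LexPos fun i => (w i).1 * γ + (w i).2 u := by
  have := h _ ⟨{(γ, u)}, rfl⟩
  rw [C.isNbhd_zeroSlice_iff, C'.isNbhd_admissible_iff hw hhalf] at this
  simpa using this

end Admissible

/-! ### The congruence on `𝕋[M]` -/

section Trop

variable {M : Type*} [AddCommGroup M]

theorem tropToBool_eq_zero_iff {a : TropSF} : tropToBool a = 0 ↔ a = 0 :=
  WithBot.map_eq_bot_iff

theorem support_tropPolyToBoolPoly (f : TropPoly M) :
    (tropPolyToBoolPoly M f).coeff.support = f.coeff.support := by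
  ext u
  rw [Finsupp.mem_support_iff, Finsupp.mem_support_iff, tropPolyToBoolPoly,
    AddMonoidAlgebra.coeff_mapRingHom, Ne, tropToBool_eq_zero_iff]

theorem tropPolyToBoolPoly_eq_zero_iff {f : TropPoly M} : tropPolyToBoolPoly M f = 0 ↔ f = 0 := by
  rw [← AddMonoidAlgebra.coeff_eq_zero, ← Finsupp.support_eq_empty, support_tropPolyToBoolPoly,
    Finsupp.support_eq_empty, AddMonoidAlgebra.coeff_eq_zero]

theorem pullToTrop_apply (P : PrimeCong (BoolPoly M)) (f g : TropPoly M) :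
    (pullToTrop P).1 f g ↔ P.1 (tropPolyToBoolPoly M f) (tropPolyToBoolPoly M g) := Iff.rfl

theorem PrimeCong.exists_max_trop (P : PrimeCong (BoolPoly M)) {f : TropPoly M} (hf : f ≠ 0) :
    ∃ u ∈ f.coeff.support, ∀ v ∈ f.coeff.support, v - u ∈ P.toTotal.1 :=
  P.toTotal.exists_max (Finsupp.support_nonempty_iff.2 (by simpa using hf))

/-! ### Lexicographic evaluation and the pulled back congruence. -/

section LexEval

variable {ℓ : ℕ} {w : Fin ℓ → ℝ × NR M} {S : TotalSubmonoid M}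

/-- Apply the hypothesis with `γ = a - b`: coefficients never influence the comparison of two terms.
-/
theorem toLex_le_iff_sub_mem
    (hw : ∀ (γ : ℝ) (u : M), u ∈ S.1 ↔ ¬ LexPos fun i => (w i).1 * γ + (w i).2 u)
    (a b : ℝ) (u v : M) :
    (toLex fun i => (w i).1 * a + (w i).2 u) ≤ (toLex fun i => (w i).1 * b + (w i).2 v) ↔
      u - v ∈ S.1 := by
  rw [toLex_le_iff, hw (a - b)]
  have : (fun i => (w i).1 * a + (w i).2 u - ((w i).1 * b + (w i).2 v)) =
      fun i => (w i).1 * (a - b) + (w i).2 (u - v) := by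
    ext i
    rw [map_sub]
    ring
  rw [this]

theorem lexEval_eq_of_max
    (hw : ∀ (γ : ℝ) (u : M), u ∈ S.1 ↔ ¬ LexPos fun i => (w i).1 * γ + (w i).2 u)
    {f : TropPoly M} {u : M} (hu : u ∈ f.coeff.support)
    (hmax : ∀ v ∈ f.coeff.support, v - u ∈ S.1) :
    lexEval w f = ((toLex fun i => (w i).1 * TropSF.log (f.coeff u) + (w i).2 u :
      Lex (Fin ℓ → ℝ)) : WithBot (Lex (Fin ℓ → ℝ))) := by
  refine le_antisymm (Finset.sup_le fun v hv => WithBot.coe_le_coe.2 ?_) ?_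
  · exact (toLex_le_iff_sub_mem hw _ _ v u).2 (hmax v hv)
  · exact Finset.le_sup (f := fun u =>
      ((toLex fun i => (w i).1 * TropSF.log (f.coeff u) + (w i).2 u : Lex (Fin ℓ → ℝ)) :
        WithBot (Lex (Fin ℓ → ℝ)))) hu

theorem lexEval_zero : lexEval w (0 : TropPoly M) = ⊥ := rfl

/-- For nonzero `f` and `g`, both sides say that the maximal exponents are equivalent for the
preorder; the class of `0` is `{0}` on both sides. -/
theorem PrimeCong.pullToTrop_iff_lexEval_eq (P : PrimeCong (BoolPoly M))
    (hw : ∀ (γ : ℝ) (u : M), u ∈ P.toTotal.1 ↔ ¬ LexPos fun i => (w i).1 * γ + (w i).2 u)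
    (f g : TropPoly M) : (pullToTrop P).1 f g ↔ lexEval w f = lexEval w g := by
  have hzero : ∀ f : TropPoly M, (pullToTrop P).1 f 0 ↔ lexEval w f = ⊥ := by
    intro f
    by_cases hf : f = 0
    · subst hf
      exact iff_of_true ((pullToTrop P).1.refl 0) lexEval_zero
    · obtain ⟨u, hu, hu'⟩ := P.exists_max_trop hf
      rw [lexEval_eq_of_max hw hu hu', pullToTrop_apply, map_zero]
      refine iff_of_false (fun h => hf ?_) WithBot.coe_ne_bot
      exact tropPolyToBoolPoly_eq_zero_iff.1 (P.eq_zero_of_rel_zero h)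
  by_cases hg : g = 0
  · subst hg
    rw [lexEval_zero, hzero]
  by_cases hf : f = 0
  · subst hf
    rw [lexEval_zero, eq_comm, ← hzero]
    exact ⟨(pullToTrop P).1.symm, (pullToTrop P).1.symm⟩
  obtain ⟨u, hu, hu'⟩ := P.exists_max_trop hf
  obtain ⟨v, hv, hv'⟩ := P.exists_max_trop hg
  rw [lexEval_eq_of_max hw hu hu', lexEval_eq_of_max hw hv hv', WithBot.coe_inj,
    le_antisymm_iff, toLex_le_iff_sub_mem hw, toLex_le_iff_sub_mem hw, pullToTrop_apply]
  refine P.rel_iff ?_ ?_ ?_ ?_ <;> rwa [support_tropPolyToBoolPoly]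

end LexEval

/-! ### The filter on the lattice of admissible fan support sets -/

/-- The intersection of an admissible fan support set with `{0} × N_ℝ`. -/
def zeroSliceSet (U : admFanLattice M) : ratFanLattice M :=
  ⟨(fun x : NR M => ((0 : ℝ), x)) ⁻¹' (U : Set (ℝ × NR M)), by
    classical
    obtain ⟨_, A, hA, hA', rfl⟩ := U
    refine ⟨Set.preimage (fun x : NR M => ((0 : ℝ), x)) '' A, hA.image _, ?_, ?_⟩
    · rintro _ ⟨D, hD, rfl⟩
      obtain ⟨s, rfl⟩ := hA' hD
      refine ⟨s.image Prod.snd, ?_⟩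
      ext x
      simp only [Set.mem_preimage, Set.mem_ofPred_eq, le_refl, true_and, zero_mul, zero_add,
        Finset.forall_mem_image]
    · rw [Set.sUnion_image, Set.preimage_sUnion]⟩

/-- The prime filter of the admissible fan support sets whose intersection with `{0} × N_ℝ` belongs
to a given prime filter. -/
def PrimeFilter.comapZeroSlice (F : PrimeFilter (ratFanLattice M)) :
    PrimeFilter (admFanLattice M) :=
  PrimeFilter.ofSet {U | zeroSliceSet U ∈ F.1}
    (by
      obtain ⟨U, hU⟩ := F.1.nonempty
      refine ⟨fanCone _ ⟨∅, rfl⟩, Order.PFilter.mem_of_le (x := U) (fun x _ => ?_) hU⟩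
      exact ⟨le_rfl, by simp⟩)
    (fun _ _ h hU => Order.PFilter.mem_of_le (Set.preimage_mono h) hU)
    (fun _ _ h h' => Order.PFilter.inf_mem h h')
    ⟨fanEmpty _, fun h => F.fanEmpty_notMem h⟩
    (fun _ _ h => F.mem_or_mem h)

theorem PrimeFilter.generatedByZeroSlice_eq (F : PrimeFilter (ratFanLattice M)) :
    (F.comapZeroSlice.1 : Set (admFanLattice M)) = generatedByZeroSlice F.1 := by
  ext U
  constructor
  · exact fun h => ⟨zeroSliceSet U, h, Set.image_preimage_subset _ _⟩
  · rintro ⟨U', hU', h⟩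
    exact Order.PFilter.mem_of_le (x := U') (fun x hx => h ⟨x, hx, rfl⟩) hU'

/-- The element `t^a` of the tropical semifield. -/
def TropSF.ofReal (a : ℝ) : TropSF := WithBot.some a

theorem TropSF.ofReal_ne_zero (a : ℝ) : TropSF.ofReal a ≠ 0 := fun h =>
  WithBot.coe_ne_bot (α := ℝ) (a := a) h

theorem tropEval_single (u : M) (a : ℝ) (w : ℝ × NR M) :
    tropEval (AddMonoidAlgebra.single u (TropSF.ofReal a)) w =
      ((w.1 * a + w.2 u : ℝ) : WithBot ℝ) := by
  rw [tropEval, AddMonoidAlgebra.coeff_single, Finsupp.support_single u (TropSF.ofReal_ne_zero a),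
    Finset.sup_singleton, Finsupp.single_eq_same]
  rfl

/-- Membership on both sides depends only on the trace on `{0} × N_ℝ`: the congruence ignores
coefficients, and so does `tropEval` where `r = 0`. -/
theorem filterOfTropCong_eq (P : PrimeCong (BoolPoly M)) (F : PrimeFilter (ratFanLattice M))
    (hF : F.toTotal = P.toTotal) :
    (F.comapZeroSlice.1 : Set (admFanLattice M)) = filterOfTropCong (pullToTrop P).1 := by
  classical
  ext U
  have hmem : U ∈ (F.comapZeroSlice.1 : Set (admFanLattice M)) ↔ zeroSliceSet U ∈ F.1 := Iff.rfl
  rw [hmem, F.mem_iff_toTotal, hF]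
  constructor
  · rintro ⟨s, hs, hsU⟩
    let m : ℝ → M → TropPoly M := fun a u => AddMonoidAlgebra.single u (TropSF.ofReal a)
    have hm : ∀ a u, tropPolyToBoolPoly M (m a u) = boolMonomial u := fun a u =>
      AddMonoidAlgebra.mapRingHom_single _ _ _
    -- Take `f₀ = 1`. The constant `t^1` imposes `r ≤ 0`, hence `r = 0`; the monomials `χ^u` with `u
    -- ∈ s` impose the inequalities of the rational cone.
    refine ⟨m 0 0, insert (m 1 0) (s.image (m 0)), fun f hf => ?_, fun w hw => ?_⟩
    · have key : ∀ a, ∀ u ∈ P.toTotal.1, (pullToTrop P).1.LeMod (m a u) (m 0 0) := by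
        intro a u hu
        rw [RingCon.LeMod, pullToTrop_apply, map_add, hm, hm]
        exact hu
      rcases Finset.mem_insert.1 hf with rfl | hf
      · exact key 1 0 (zero_mem _)
      · obtain ⟨u, hu, rfl⟩ := Finset.mem_image.1 hf
        exact key 0 u (hs u hu)
    · obtain ⟨r, x⟩ := w
      obtain ⟨hr, hw⟩ := hw
      have h1 := hw _ (Finset.mem_insert_self _ _)
      simp only [m, tropEval_single, WithBot.coe_le_coe] at h1
      simp only [mul_one, map_zero, add_zero, mul_zero] at h1
      have hr0 : r = 0 := le_antisymm h1 hr
      subst hr0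
      refine hsU fun u hu => ?_
      have h2 := hw _ (Finset.mem_insert_of_mem (Finset.mem_image_of_mem (m 0) hu))
      simpa only [m, tropEval_single, WithBot.coe_le_coe, mul_zero, zero_add, map_zero] using h2
  · rintro ⟨f₀, s, hs, hU⟩
    by_cases hf₀ : f₀ = 0
    · refine ⟨∅, by simp, fun x _ => hU ⟨le_rfl, fun f hf => ?_⟩⟩
      have h := hs f hf
      rw [RingCon.LeMod, hf₀, add_zero, pullToTrop_apply, map_zero] at h
      rw [tropPolyToBoolPoly_eq_zero_iff.1 (P.eq_zero_of_rel_zero h), hf₀]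
    obtain ⟨u, hu, hmax⟩ := P.exists_max_trop hf₀
    -- With `u` a maximal exponent of `f₀`, the conditions `⟨x, v - u⟩ ≤ 0` for all exponents `v` of
    -- all `f` in `s` ensure `f(0, x) ≤ f₀(0, x)`.
    refine ⟨(s.biUnion fun f => f.coeff.support).image fun v => v - u, fun z hz => ?_,
      fun x hx => hU ⟨le_rfl, fun f hf => ?_⟩⟩
    · obtain ⟨v, hv, rfl⟩ := Finset.mem_image.1 hz
      obtain ⟨f, hf, hv⟩ := Finset.mem_biUnion.1 hv
      have h := hs f hf
      rw [RingCon.LeMod, pullToTrop_apply] at h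
      have hne : f + f₀ ≠ 0 := fun h0 => hf₀ (by
        rw [h0, map_zero] at h
        exact tropPolyToBoolPoly_eq_zero_iff.1 (P.eq_zero_of_rel_zero (P.1.symm h)))
      obtain ⟨z, hz, hz'⟩ := P.exists_max_trop hne
      -- Maxima do not cancel, so `v` stays in the support of `f + f₀`, whose maximal exponent is
      -- equivalent to `u`.
      have hvz : v ∈ (f + f₀).coeff.support := by
        rw [Finsupp.mem_support_iff] at hv ⊢
        intro h0
        exact hv (max_eq_bot (α := WithBot ℝ) |>.1 h0).1
      rw [P.rel_iff (u := z) (v := u) (by rwa [support_tropPolyToBoolPoly])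
        (by rwa [support_tropPolyToBoolPoly]) (by rwa [support_tropPolyToBoolPoly])
        (by rwa [support_tropPolyToBoolPoly])] at h
      simpa using P.toTotal.1.add_mem (hz' v hvz) h.1
    · refine Finset.sup_le fun v hv => ?_
      refine le_trans ?_ (Finset.le_sup (f := fun u =>
        (((0 : ℝ) * TropSF.log (f₀.coeff u) + x u : ℝ) : WithBot ℝ)) hu)
      have h := hx (v - u) (Finset.mem_image_of_mem _ (Finset.mem_biUnion.2 ⟨f, hf, hv⟩))
      rw [map_sub] at h
      rw [WithBot.coe_le_coe]
      linarith

end Trop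

end

/-! ### Assembly of the bijections through total submonoids. -/

theorem mainTheorem9 {M : Type*} [AddCommGroup M] (n : ℕ) (e : M ≃+ (Fin n → ℤ))
    (k : Type*) [CommRing k] [Nontrivial k] :
    ∃ (flagToPrime : Quotient (ratLocEquiv M) ≃ PrimeCong (BoolPoly M))
      (primeToFilter : PrimeCong (BoolPoly M) ≃ PrimeFilter (ratFanLattice M))
      (primeToPreorder : PrimeCong (BoolPoly M) ≃ MonomialPreorder (LaurentMonomials k n)),
      (∀ C : ConeFlag (NR M),
        (∃ C' : ConeFlag (ℝ × NR M), C'.InHalfSpace ∧ C'.IsSimplicial ∧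
          ConeFlag.LocEquiv (admissibleCones M) C.zeroSlice C') ∧
        ∀ C' : ConeFlag (ℝ × NR M), C'.InHalfSpace → C'.IsSimplicial →
          ConeFlag.LocEquiv (admissibleCones M) C.zeroSlice C' →
          C'.Defines (pullToTrop (flagToPrime (Quotient.mk (ratLocEquiv M) C))).1) ∧
      (∀ P : PrimeCong (BoolPoly M), ∃ G : PrimeFilter (admFanLattice M),
        (G.1 : Set (admFanLattice M)) = filterOfTropCong (pullToTrop P).1 ∧
        (G.1 : Set (admFanLattice M)) = generatedByZeroSlice (primeToFilter P).1) ∧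
      (∀ (P : PrimeCong (BoolPoly M)) (u v : Fin n → ℤ),
        (primeToPreorder P).le (laurentMonomial k u) (laurentMonomial k v) ↔
          P.1.LeMod (AddMonoidAlgebra.single (e.symm u) 1)
            (AddMonoidAlgebra.single (e.symm v) 1)) := by
  have : Module.Finite ℝ (NR M) := NR.finite_of_equiv e
  have : Module.Finite ℤ M := Module.Finite.equiv e.symm.toIntLinearEquiv
  have : AddGroup.FG M := Module.Finite.iff_addGroup_fg.1 this
  refine ⟨(flagEquiv M).trans (primeCongEquiv M).symm,
    (primeCongEquiv M).trans (filterEquiv M).symm,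
    (primeCongEquiv M).trans (totalSubmonoidEquivPreorder (laurentMonomialEquiv e k)),
    fun C => ⟨C.exists_simplicial_locEquiv_zeroSlice, fun C' hhalf _ hloc =>
      ⟨C'.exists_isChoice, fun w hw => ?_⟩⟩, fun P => ?_, fun P u v => ?_⟩
  · refine PrimeCong.pullToTrop_iff_lexEval_eq _ fun γ u => ?_
    rw [← C.mem_toTotal_iff_of_locEquiv hhalf hloc hw γ u]
    have h : ((primeCongEquiv M).symm C.toTotal).toTotal = C.toTotal :=
      (primeCongEquiv M).apply_symm_apply _
    exact (congrArg (fun S : TotalSubmonoid M => u ∈ S.1) h).to_iff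
  · exact ⟨((filterEquiv M).symm P.toTotal).comapZeroSlice,
      filterOfTropCong_eq P _ ((filterEquiv M).apply_symm_apply _),
      PrimeFilter.generatedByZeroSlice_eq _⟩
  · rw [← P.sub_mem_toTotal]
    change ((laurentMonomialEquiv e k).symm (laurentMonomial k u)).toAdd -
      ((laurentMonomialEquiv e k).symm (laurentMonomial k v)).toAdd ∈ P.toTotal.1 ↔ _
    rw [laurentMonomialEquiv_symm, laurentMonomialEquiv_symm]
    rfl
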